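/- Let $d\in\mathbb N$, $1\le\alpha<2$. Let $M:\mathbb R^d\to\mathbb R$ be twice differentiable with $M>0$, $M(-v)=M(v)$, $\int_{\mathbb R^d} M\,dv=1$, $|v|^{d+\alpha}M(v)\to\gamma$ as $|v|\to\infty$ for some $\gamma>0$, and $|D_vM(v)|\le C\frac{M(v)}{1+|v|}$, $|D_v^2M(v)|\le C\,M(v)$ for all $v$. Let $\sigma:\mathbb R^d\times\mathbb R^d\to\mathbb R$ be differentiable in each variable, with $\sigma(v,v')=\sigma(v',v)$, $0<\nu_1\le\sigma(v,v')\le\nu_2$, $|\nabla_v\sigma(v',v)|\le\frac{C}{1+|v|}$ and $|\sigma(v,v')-\nu_0|\le\frac{C}{1+|v|}$ for all $v,v'$ and some constants $C,\nu_0,\nu_1,\nu_2$; assume also that $\nu(v)=\int_{\mathbb R^d}\sigma(v',v)M(v')\,dv'$ is even. Put $$Q(f)(v)=\int_{\mathbb R^d}\big(\sigma(v,v')M(v)f(v')-\sigma(v',v)M(v')f(v)\big)\,dv',\qquad \|f\|_{L^2_{M^{-1}}}=\Big(\int_{\mathbb R^d}|f(v)|^2\,\frac{dv}{M(v)}\Big)^{1/2},$$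 where $Q$ acts componentwise on vector fields. (a) For every $E\in\mathbb R^d$ there is a unique $F(\cdot,E)\in L^2_{M^{-1}}(\mathbb R^d)$ that satisfies $E\cdot\nabla_vF-Q(F)=0$ in the sense of distributions and $\int_{\mathbb R^d}F(v,E)\,dv=1$. It has a continuous representative, which is positive everywhere; $F(\cdot,E)$ denotes this representative. (b) There is a unique $\lambda\in(L^2_{M^{-1}}(\mathbb R^d))^d$ with $Q(\lambda)=\nabla_vM$ almost everywhere and $\int_{\mathbb R^d}\lambda\,dv=0$; it has a representative for which $Q(\lambda)(v)=\nabla_vM(v)$ at every $v$, and $\lambda$ denotes this representative. (c) Define $G$ by $$F(v,E)=M(v)+E\cdot\lambda(v)+G(v,E).$$ There is a constant $C>0$, independent of $E$ and $v$, such that for all $|E|\le1$ $$\|G(\cdot,E)\|_{L^2_{M^{-1}}(\mathbb R^d)}\le C|E|^2,\qquad |G(v,E)|\le C|E|^2M(v)\quad\text{for all }v\in\mathbb R^d.$$ -/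

import Mathlib

open MeasureTheory Filter Topology
open scoped ContDiff

/-- The collision frequency `ν(v) = ∫ σ(v', v) M(v') dv'`. -/
noncomputable def collisionFreq {d : ℕ}
    (σ : EuclideanSpace ℝ (Fin d) → EuclideanSpace ℝ (Fin d) → ℝ)
    (M : EuclideanSpace ℝ (Fin d) → ℝ) (v : EuclideanSpace ℝ (Fin d)) : ℝ :=
  ∫ v', σ v' v * M v'

/-- The linear Boltzmann operator
`Q(f)(v) = ∫ (σ(v, v') M(v) f(v') - σ(v', v) M(v') f(v)) dv'`,
for scalar functions `f` (`H = ℝ`) and, componentwise, for vector fields. -/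
noncomputable def boltzmannQ {d : ℕ} {H : Type*} [NormedAddCommGroup H] [NormedSpace ℝ H]
    (σ : EuclideanSpace ℝ (Fin d) → EuclideanSpace ℝ (Fin d) → ℝ)
    (M : EuclideanSpace ℝ (Fin d) → ℝ) (f : EuclideanSpace ℝ (Fin d) → H)
    (v : EuclideanSpace ℝ (Fin d)) : H :=
  ∫ v', ((σ v v' * M v) • f v' - (σ v' v * M v') • f v)

/-- The measure `dv / M(v)`; the space `L²_{M⁻¹}(ℝᵈ)` is the `L²` space of this measure. -/
noncomputable def invWeight {d : ℕ} (M : EuclideanSpace ℝ (Fin d) → ℝ) :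
    Measure (EuclideanSpace ℝ (Fin d)) :=
  volume.withDensity (fun v => ENNReal.ofReal ((M v)⁻¹))

/-- Assumptions on the thermodynamical equilibrium `M`: a positive, even probability density,
with a heavy tail of exponent `d + α`, `1 ≤ α < 2`, twice differentiable, with
`|DM| ≤ C M / (1 + |v|)` and `|D²M| ≤ C M`. -/
structure HeavyTailEquilibrium {d : ℕ} (α : ℝ) (M : EuclideanSpace ℝ (Fin d) → ℝ) : Prop where
  one_le_alpha : 1 ≤ α
  alpha_lt_two : α < 2
  pos : ∀ v, 0 < M v
  even : ∀ v, M (-v) = M v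
  integral_eq_one : ∫ v, M v = 1
  tail : ∃ γ : ℝ, 0 < γ ∧
    Tendsto (fun v => ‖v‖ ^ ((d : ℝ) + α) * M v)
      (Bornology.cobounded (EuclideanSpace ℝ (Fin d))) (𝓝 γ)
  differentiable : Differentiable ℝ M
  differentiable_fderiv : Differentiable ℝ (fderiv ℝ M)
  fderiv_bound : ∃ C : ℝ, ∀ v, ‖fderiv ℝ M v‖ ≤ C * (M v / (1 + ‖v‖))
  fderiv_fderiv_bound : ∃ C : ℝ, ∀ v, ‖fderiv ℝ (fderiv ℝ M) v‖ ≤ C * M v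

/-- Assumptions on the cross section `σ`: symmetric, bounded between two positive constants,
differentiable in each variable with `|∇_v σ(v', v)| ≤ C / (1 + |v|)`, with an even collision
frequency, and with `|σ(v, v') - ν₀| ≤ C / (1 + |v|)` for some `ν₀`. -/
structure AdmissibleCrossSection {d : ℕ} (M : EuclideanSpace ℝ (Fin d) → ℝ)
    (σ : EuclideanSpace ℝ (Fin d) → EuclideanSpace ℝ (Fin d) → ℝ) : Prop where
  symm : ∀ v v', σ v v' = σ v' v
  bounds : ∃ ν₁ ν₂ : ℝ, 0 < ν₁ ∧ ∀ v v', ν₁ ≤ σ v v' ∧ σ v v' ≤ ν₂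
  differentiable : ∀ v', Differentiable ℝ (fun v => σ v' v)
  fderiv_bound : ∃ C : ℝ, ∀ v' v, ‖fderiv ℝ (fun w => σ v' w) v‖ ≤ C / (1 + ‖v‖)
  freq_even : ∀ v, collisionFreq σ M (-v) = collisionFreq σ M v
  limit : ∃ ν₀ C : ℝ, ∀ v v', |σ v v' - ν₀| ≤ C / (1 + ‖v‖)

/-- `f ∈ L²_{M⁻¹}(ℝᵈ)` solves `E · ∇f - Q(f) = 0` in the sense of distributions, with unit mass.
(As `Q(f) ∈ L²_{M⁻¹}`, such an `f` has its distributional derivative `E · ∇f` in `L²_{M⁻¹}`.) -/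
structure IsModifiedEquilibrium {d : ℕ}
    (σ : EuclideanSpace ℝ (Fin d) → EuclideanSpace ℝ (Fin d) → ℝ)
    (M : EuclideanSpace ℝ (Fin d) → ℝ) (E : EuclideanSpace ℝ (Fin d))
    (f : EuclideanSpace ℝ (Fin d) → ℝ) : Prop where
  memLp : MemLp f 2 (invWeight M)
  weak_eq : ∀ φ : EuclideanSpace ℝ (Fin d) → ℝ, ContDiff ℝ ∞ φ → HasCompactSupport φ →
    -∫ v, f v * fderiv ℝ φ v E = ∫ v, boltzmannQ σ M f v * φ v
  mass : ∫ v, f v = 1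

/-! ### Inverting `E · ∇ + ν` along lines -/

section Transport

variable {V : Type*} [NormedAddCommGroup V] [NormedSpace ℝ V]
  {H : Type*} [NormedAddCommGroup H] [NormedSpace ℝ H]

/-! Write `Q(f) = M ∫ σ f - ν f` and split `σ = ν₁ + (σ - ν₁)`, where `ν₁ > 0` is a lower bound of
`σ`. The constant part sees only the total mass of `f`, so prescribing the mass turns `E · ∇f =
Q(f)` into `E · ∇f + ν f = M (s + K f)`, with a known source `s` and the nonnegative operator `K f =
∫ (σ - ν₁) f`.

Let `T` be the inverse of `E · ∇ + ν`, given by integration backwards along lines. Two mass balances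
carry the argument: `∫ ν T g = ∫ g` and `∫ M K f = ∫ ν f - ν₁ ∫ f`. The loss `ν₁ ∫ f` makes `b ↦ s +
K T (M b)` a strict contraction for the norm `∫ M |b|`. Since `K` maps `L¹` to bounded functions,
some iterate also contracts in the sup norm, and Banach's theorem gives the fixed point
(`exists_stationary`). As `M` varies only subexponentially along lines while `T` damps
exponentially, `T` preserves bounds by multiples of `M`, hence every solution constructed here is
`O(M)`.

The source `s = ν₁` gives `F`. Its positivity comes from the `L¹` bound `∫ |F| ≤ 1 = ∫ F`. The field
`E = 0` with `s = -∇M / M` gives `λ`. Uniqueness follows from the same loss of mass, once integrable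
weak solutions are known to satisfy `∫ ν |u| ≤ ∫ |h|` (`integral_freq_mul_abs_le_of_weak`).

The remainder `G` has mean zero and solves `E · ∇G + ν G = M K G - E · (E · ∇)λ`. Since `|∇λ| ≤ C
M`, the last term is `O(|E|² M)`. The loss of mass bounds `∫ |G|` by `C |E|²`, and one application
of `T` turns this into the pointwise bound (`abs_remainder_le`). The weighted `L²` bound is a
consequence, because `M` has norm one in that space. -/

/-- The integral `∫₀ˣ ν(v + τE) dτ` of the frequency `ν` along the line through `v`
directed by `E`. -/
noncomputable def lineDepth (ν : V → ℝ) (E v : V) (x : ℝ) : ℝ := ∫ τ in (0 : ℝ)..x, ν (v + τ • E)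

/-- The solution operator `g ↦ f` of the transport equation `E · ∇f + ν f = g`. -/
noncomputable def transportInv (ν : V → ℝ) (E : V) (g : V → H) (v : V) : H :=
  ∫ x in Set.Iic (0 : ℝ), Real.exp (lineDepth ν E v x) • g (v + x • E)

omit [NormedSpace ℝ H] in
theorem integrable_of_norm_le_mul [MeasurableSpace V] [BorelSpace V] [FiniteDimensional ℝ V]
    {μ : Measure V} {M : V → ℝ} {g : V → H} {B : ℝ} (hM : Integrable M μ) (hg : Continuous g)
    (hgM : ∀ v, ‖g v‖ ≤ B * M v) : Integrable g μ :=
  (hM.const_mul B).mono' hg.aestronglyMeasurable (Eventually.of_forall hgM)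

/-- A frequency `ν ≥ 2c > 0` and a bounded weight `M` that grows at most like `exp (c |x|)`
backwards along the lines directed by `E`. -/
structure DampedTransport (ν M : V → ℝ) (E : V) (c A : ℝ) : Prop where
  continuous_freq : Continuous ν
  continuous_weight : Continuous M
  rate_pos : 0 < c
  le_freq : ∀ v, 2 * c ≤ ν v
  weight_pos : ∀ v, 0 < M v
  weight_bounded : ∃ B, ∀ v, M v ≤ B
  growth : ∀ v, ∀ x ≤ (0 : ℝ), M (v + x • E) ≤ A * Real.exp (-(c * x)) * M v

theorem HasLineDerivAt.hasDerivAt_line {y y' : V → H} {E : V}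
    (h : ∀ v, HasLineDerivAt ℝ y (y' v) v E) (v : V) (t : ℝ) :
    HasDerivAt (fun s : ℝ => y (v + s • E)) (y' (v + t • E)) t := by
  have h1 : HasDerivAt (fun s : ℝ => y (v + t • E + s • E)) (y' (v + t • E)) (t - t) := by
    rw [sub_self]; exact h (v + t • E)
  refine (h1.comp_sub_const t t).congr_of_eventuallyEq (Eventually.of_forall fun s => ?_)
  simp only [sub_smul]
  congr 1
  abel

section LineDepth

variable {ν : V → ℝ} (hν : Continuous ν) (E : V)
include hν

theorem hasDerivAt_lineDepth (v : V) (x : ℝ) :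
    HasDerivAt (lineDepth ν E v) (ν (v + x • E)) x := by
  have hc : Continuous fun τ : ℝ => ν (v + τ • E) := by fun_prop
  exact intervalIntegral.integral_hasDerivAt_right (hc.intervalIntegrable _ _)
    (hc.stronglyMeasurableAtFilter _ _) hc.continuousAt

theorem continuous_lineDepth (v : V) : Continuous (lineDepth ν E v) :=
  continuous_iff_continuousAt.2 fun x => (hasDerivAt_lineDepth hν E v x).continuousAt

theorem continuous_lineDepth_left (x : ℝ) : Continuous fun v => lineDepth ν E v x := by
  refine intervalIntegral.continuous_parametric_intervalIntegral_of_continuous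
    (f := fun (v : V) (τ : ℝ) => ν (v + τ • E)) ?_ continuous_const
  have : Continuous fun p : V × ℝ => ν (p.1 + p.2 • E) := by fun_prop
  exact this

theorem lineDepth_shift (v : V) (t x : ℝ) :
    lineDepth ν E (v + t • E) x = lineDepth ν E v (x + t) - lineDepth ν E v t := by
  have hc : Continuous fun τ : ℝ => ν (v + τ • E) := by fun_prop
  have h1 : lineDepth ν E (v + t • E) x = ∫ τ in (0 : ℝ)..x, (fun τ => ν (v + τ • E)) (τ + t) := by
    refine intervalIntegral.integral_congr fun τ _ => ?_
    simp only [add_smul]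
    congr 1
    abel
  rw [h1, intervalIntegral.integral_comp_add_right (fun τ => ν (v + τ • E)), zero_add, lineDepth,
    lineDepth, intervalIntegral.integral_interval_sub_left (hc.intervalIntegrable _ _)
      (hc.intervalIntegrable _ _)]

theorem lineDepth_le {c : ℝ} (hc : ∀ v, c ≤ ν v) (v : V) {x : ℝ} (hx : x ≤ 0) :
    lineDepth ν E v x ≤ c * x := by
  have hcont : Continuous fun τ : ℝ => ν (v + τ • E) := by fun_prop
  have h := intervalIntegral.integral_mono_on (μ := volume) hx
    (continuous_const.intervalIntegrable x 0) (hcont.intervalIntegrable x 0) fun τ _ => hc (v + τ • E)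
  rw [intervalIntegral.integral_const, smul_eq_mul] at h
  rw [lineDepth, intervalIntegral.integral_symm]
  linarith

end LineDepth

theorem lineDepth_zero (ν : V → ℝ) (E v : V) : lineDepth ν E v 0 = 0 :=
  intervalIntegral.integral_same

namespace DampedTransport

variable {ν M : V → ℝ} {E : V} {c A : ℝ} (D : DampedTransport ν M E c A)
include D

theorem A_pos : 0 < A := by
  have h := D.growth 0 0 le_rfl
  have hM := D.weight_pos 0
  simp only [zero_smul, add_zero, mul_zero, neg_zero, Real.exp_zero, mul_one] at h
  by_contra hA
  nlinarith

theorem exp_lineDepth_le (v : V) {x : ℝ} (hx : x ≤ 0) :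
    Real.exp (lineDepth ν E v x) ≤ Real.exp (c * x) * Real.exp (c * x) := by
  rw [← Real.exp_add]
  refine Real.exp_le_exp.2 ?_
  have := lineDepth_le D.continuous_freq E D.le_freq v hx
  linarith

/-- This is why the frequency is bounded below by `2 * c` rather than `c`: one factor `exp (c x)`
absorbs the growth of the weight, and the other remains to make the integral over `x ≤ 0` converge.
-/
theorem exp_mul_weight_le (v : V) {x : ℝ} (hx : x ≤ 0) :
    Real.exp (lineDepth ν E v x) * M (v + x • E) ≤ A * M v * Real.exp (c * x) := by
  have h1 := D.exp_lineDepth_le v hx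
  have h2 := D.growth v x hx
  have hM := (D.weight_pos v).le
  calc Real.exp (lineDepth ν E v x) * M (v + x • E)
      ≤ (Real.exp (c * x) * Real.exp (c * x)) * (A * Real.exp (-(c * x)) * M v) := by
        have := (D.weight_pos (v + x • E)).le
        gcongr
    _ = A * M v * Real.exp (c * x) * (Real.exp (c * x) * Real.exp (-(c * x))) := by ring
    _ = A * M v * Real.exp (c * x) := by rw [← Real.exp_add]; simp

variable {g : V → H} {B : ℝ}

theorem norm_integrand_le (hgM : ∀ v, ‖g v‖ ≤ B * M v) (v : V) {x : ℝ} (hx : x ≤ 0) :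
    ‖Real.exp (lineDepth ν E v x) • g (v + x • E)‖ ≤ B * A * M v * Real.exp (c * x) := by
  have hB : 0 ≤ B := by
    have := (norm_nonneg _).trans (hgM 0)
    exact nonneg_of_mul_nonneg_left this (D.weight_pos 0)
  rw [norm_smul, Real.norm_eq_abs, abs_of_pos (Real.exp_pos _)]
  calc Real.exp (lineDepth ν E v x) * ‖g (v + x • E)‖
      ≤ Real.exp (lineDepth ν E v x) * (B * M (v + x • E)) := by gcongr; exact hgM _
    _ = B * (Real.exp (lineDepth ν E v x) * M (v + x • E)) := by ring
    _ ≤ B * (A * M v * Real.exp (c * x)) :=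
        mul_le_mul_of_nonneg_left (D.exp_mul_weight_le v hx) hB
    _ = _ := by ring

theorem continuous_integrand (hg : Continuous g) (v : V) :
    Continuous fun x : ℝ => Real.exp (lineDepth ν E v x) • g (v + x • E) := by
  have := continuous_lineDepth D.continuous_freq E v
  fun_prop

theorem integrableOn_integrand (hg : Continuous g) (hgM : ∀ v, ‖g v‖ ≤ B * M v) (v : V) (t : ℝ) :
    IntegrableOn (fun x : ℝ => Real.exp (lineDepth ν E v x) • g (v + x • E)) (Set.Iic t) := by
  have hc := D.continuous_integrand hg v
  have h0 : IntegrableOn (fun x : ℝ => Real.exp (lineDepth ν E v x) • g (v + x • E))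
      (Set.Iic 0) := by
    refine Integrable.mono' ((integrableOn_exp_mul_Iic D.rate_pos 0).const_mul (B * A * M v))
      hc.aestronglyMeasurable ?_
    exact (ae_restrict_iff' measurableSet_Iic).2
      (Eventually.of_forall fun x hx => D.norm_integrand_le hgM v hx)
  rcases le_total t 0 with ht | ht
  · exact h0.mono_set (Set.Iic_subset_Iic.2 ht)
  · rw [← Set.Iic_union_Icc_eq_Iic ht]
    exact h0.union hc.continuousOn.integrableOn_Icc

theorem norm_transportInv_le_mul (hgM : ∀ v, ‖g v‖ ≤ B * M v) (v : V) :
    ‖transportInv ν E g v‖ ≤ B * A / c * M v := by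
  have h := norm_integral_le_of_norm_le
    ((integrableOn_exp_mul_Iic D.rate_pos 0).const_mul (B * A * M v))
    ((ae_restrict_iff' measurableSet_Iic).2
      (Eventually.of_forall fun x hx => D.norm_integrand_le hgM v hx))
  rw [integral_const_mul, integral_exp_mul_Iic D.rate_pos] at h
  simp only [mul_zero, Real.exp_zero] at h
  calc _ ≤ _ := h
    _ = _ := by ring

theorem continuous_transportInv (hg : Continuous g) (hgM : ∀ v, ‖g v‖ ≤ B * M v) :
    Continuous (transportInv ν E g) := by
  obtain ⟨M₀, hM₀⟩ := D.weight_bounded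
  have hB : 0 ≤ B := by
    have := (norm_nonneg _).trans (hgM 0)
    exact nonneg_of_mul_nonneg_left this (D.weight_pos 0)
  have hA := D.A_pos
  -- The dominating function must not depend on `v`; this is where boundedness of the weight enters.
  refine continuous_of_dominated (bound := fun x => B * A * M₀ * Real.exp (c * x))
    (fun v => (D.continuous_integrand hg v).aestronglyMeasurable) (fun v => ?_)
    ((integrableOn_exp_mul_Iic D.rate_pos 0).const_mul _) (Eventually.of_forall fun x => ?_)
  · refine (ae_restrict_iff' measurableSet_Iic).2
      (Eventually.of_forall fun x hx => (D.norm_integrand_le hgM v hx).trans ?_)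
    gcongr
    exact hM₀ v
  · have := continuous_lineDepth_left D.continuous_freq E x
    fun_prop

/-- Along a line the integrand becomes independent of `t`, which survives only in a prefactor and in
the upper limit. The derivative along `E` is then the fundamental theorem of calculus. -/
theorem transportInv_line (g : V → H) (v : V) (t : ℝ) :
    transportInv ν E g (v + t • E) = Real.exp (-lineDepth ν E v t) •
      ∫ x in Set.Iic t, Real.exp (lineDepth ν E v x) • g (v + x • E) := by
  have h := (measurePreserving_add_right (volume : Measure ℝ) t).setIntegral_preimage_emb
    (measurableEmbedding_addRight t)
    (fun x => Real.exp (-lineDepth ν E v t) • Real.exp (lineDepth ν E v x) • g (v + x • E))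
    (Set.Iic t)
  rw [← integral_smul, ← h]
  have hs : (fun x : ℝ => x + t) ⁻¹' Set.Iic t = Set.Iic 0 := by
    ext x; simp
  rw [hs, transportInv]
  congr 1
  funext x
  rw [lineDepth_shift D.continuous_freq, smul_smul, ← Real.exp_add]
  congr 2
  · ring
  · rw [add_smul]; abel

variable [CompleteSpace H]

theorem hasLineDerivAt_transportInv (hg : Continuous g) (hgM : ∀ v, ‖g v‖ ≤ B * M v) (v : V) :
    HasLineDerivAt ℝ (transportInv ν E g) (g v - ν v • transportInv ν E g v) v E := by
  have hc := D.continuous_integrand hg v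
  have hint := D.integrableOn_integrand hg hgM v
  have h1 : HasDerivAt (fun t => ∫ x in Set.Iic t,
      Real.exp (lineDepth ν E v x) • g (v + x • E)) (g v) 0 := by
    have h2 := intervalIntegral.integral_hasDerivAt_right (hc.intervalIntegrable 0 0)
      (hc.stronglyMeasurableAtFilter _ _) hc.continuousAt
    simp only [lineDepth_zero, Real.exp_zero, zero_smul, add_zero, one_smul] at h2
    refine (h2.add_const (transportInv ν E g v)).congr_of_eventuallyEq
      (Eventually.of_forall fun t => ?_)
    simp only [transportInv]
    rw [← intervalIntegral.integral_Iic_sub_Iic (hint 0) (hint t)]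
    abel
  have h3 : HasDerivAt (fun t => Real.exp (-lineDepth ν E v t)) (-ν v) 0 := by
    have := (hasDerivAt_lineDepth D.continuous_freq E v 0).neg.exp
    simpa [lineDepth_zero] using this
  have h4 := h3.smul h1
  simp only [lineDepth_zero, neg_zero, Real.exp_zero, one_smul, neg_smul] at h4
  rw [HasLineDerivAt]
  refine (h4.congr_deriv ?_).congr_of_eventuallyEq
    (Eventually.of_forall fun t => D.transportInv_line g v t)
  rw [sub_eq_add_neg]
  rfl

omit D [CompleteSpace H] in
theorem norm_transportInv_le (g : V → H) (v : V) :
    ‖transportInv ν E g v‖ ≤ transportInv ν E (fun w => ‖g w‖) v := by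
  refine (norm_integral_le_integral_norm _).trans_eq ?_
  simp only [norm_smul, Real.norm_eq_abs, abs_of_pos (Real.exp_pos _), transportInv, smul_eq_mul]

omit D [CompleteSpace H] in
theorem transportInv_nonneg {g : V → ℝ} (hg : ∀ v, 0 ≤ g v) (v : V) :
    0 ≤ transportInv ν E g v :=
  integral_nonneg fun _ => smul_nonneg (Real.exp_pos _).le (hg _)

omit [CompleteSpace H] in
theorem transportInv_pos {g : V → ℝ} (hg : Continuous g) (hgM : ∀ v, ‖g v‖ ≤ B * M v)
    (h0 : ∀ v, 0 < g v) (v : V) : 0 < transportInv ν E g v := by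
  have hpos : ∀ x, 0 < Real.exp (lineDepth ν E v x) • g (v + x • E) := fun x =>
    smul_pos (Real.exp_pos _) (h0 _)
  refine (setIntegral_pos_iff_support_of_nonneg_ae (Eventually.of_forall fun x => (hpos x).le)
    (D.integrableOn_integrand hg hgM v 0)).2 ?_
  have : Function.support (fun x => Real.exp (lineDepth ν E v x) • g (v + x • E)) = Set.univ :=
    Set.eq_univ_of_forall fun x => (hpos x).ne'
  rw [this]
  simp

omit [CompleteSpace H] in
theorem transportInv_sub {g' : V → H} {B' : ℝ} (hg : Continuous g) (hgM : ∀ v, ‖g v‖ ≤ B * M v)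
    (hg' : Continuous g') (hgM' : ∀ v, ‖g' v‖ ≤ B' * M v) (v : V) :
    transportInv ν E (fun w => g w - g' w) v = transportInv ν E g v - transportInv ν E g' v := by
  rw [transportInv, transportInv, transportInv, ← integral_sub
    (D.integrableOn_integrand hg hgM v 0) (D.integrableOn_integrand hg' hgM' v 0)]
  simp only [smul_sub]

omit [CompleteSpace H] in
theorem transportInv_mono {g g' : V → ℝ} {B' : ℝ} (hg : Continuous g)
    (hgM : ∀ v, ‖g v‖ ≤ B * M v) (hg' : Continuous g') (hgM' : ∀ v, ‖g' v‖ ≤ B' * M v)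
    (h : ∀ v, g v ≤ g' v) (v : V) : transportInv ν E g v ≤ transportInv ν E g' v := by
  have h1 := transportInv_nonneg (ν := ν) (E := E) (fun w => sub_nonneg.2 (h w)) v
  rw [D.transportInv_sub hg' hgM' hg hgM] at h1
  linarith

omit [CompleteSpace H] in
/-- Comparison: a solution of `E · ∇y + ν y = h` with `‖h‖ ≤ g` that is dominated by the weight is
bounded by the solution with right-hand side `g`. -/
theorem norm_le_transportInv {y h : V → H} {g : V → ℝ} {B' : ℝ}
    (hy : ∀ v, HasLineDerivAt ℝ y (h v - ν v • y v) v E) (hyM : ∀ v, ‖y v‖ ≤ B' * M v)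
    (hg : Continuous g) (hgM : ∀ v, ‖g v‖ ≤ B * M v) (hh : ∀ v, ‖h v‖ ≤ g v) (v : V) :
    ‖y v‖ ≤ transportInv ν E g v := by
  have hder : ∀ x : ℝ, HasDerivAt (fun x => Real.exp (lineDepth ν E v x) • y (v + x • E))
      (Real.exp (lineDepth ν E v x) • h (v + x • E)) x := fun x => by
    have h2 := (hasDerivAt_lineDepth D.continuous_freq E v x).exp.smul
      (HasLineDerivAt.hasDerivAt_line hy v x)
    refine h2.congr_deriv ?_
    module
  -- The boundary term at `-∞` vanishes because `y` is dominated by the weight; without this,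
  -- homogeneous solutions would spoil the comparison.
  have hz : Tendsto (fun R : ℝ => Real.exp (lineDepth ν E v R) • y (v + R • E)) atBot (𝓝 0) := by
    have hexp : Tendsto (fun R : ℝ => B' * A * M v * Real.exp (c * R)) atBot (𝓝 0) := by
      have := (Real.tendsto_exp_atBot.comp
        (tendsto_id.const_mul_atBot D.rate_pos)).const_mul (B' * A * M v)
      simpa using this
    refine squeeze_zero_norm' ?_ hexp
    filter_upwards [eventually_le_atBot 0] with R hR using D.norm_integrand_le hyM v hR
  have hlim := intervalIntegral_tendsto_integral_Iic (0 : ℝ) (D.integrableOn_integrand hg hgM v 0)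
    (tendsto_id (α := ℝ) (x := atBot))
  have hlim2 : Tendsto (fun R : ℝ => ‖y v - Real.exp (lineDepth ν E v R) • y (v + R • E)‖) atBot
      (𝓝 ‖y v - 0‖) := (hz.const_sub _).norm
  rw [sub_zero] at hlim2
  refine le_of_tendsto_of_tendsto hlim2 hlim ?_
  filter_upwards [eventually_le_atBot 0] with R hR
  have h5 := norm_sub_le_integral_of_norm_deriv_le_of_le hR
    (f := fun x => Real.exp (lineDepth ν E v x) • y (v + x • E))
    (B := fun x => Real.exp (lineDepth ν E v x) • g (v + x • E))
    (fun x _ => (hder x).continuousAt.continuousWithinAt)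
    (fun x _ => (hder x).differentiableAt.differentiableWithinAt)
    (Eventually.of_forall fun x _ => by
      rw [(hder x).deriv, norm_smul, Real.norm_eq_abs, abs_of_pos (Real.exp_pos _), smul_eq_mul]
      gcongr
      exact hh _)
    ((D.continuous_integrand hg v).intervalIntegrable _ _)
  simpa [lineDepth_zero] using h5

variable [MeasurableSpace V] [BorelSpace V] [FiniteDimensional ℝ V]
  {μ : Measure V} [μ.IsAddHaarMeasure]

/-- Conservation of mass: integrating `E · ∇f + ν f = g` over the space kills the transport term, by
integration by parts against the constant `1`. -/
theorem integral_freq_smul_transportInv (hM : Integrable M μ) {ν₂ : ℝ} (hν : ∀ v, ν v ≤ ν₂)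
    (hg : Continuous g) (hgM : ∀ v, ‖g v‖ ≤ B * M v) :
    ∫ v, ν v • transportInv ν E g v ∂μ = ∫ v, g v ∂μ := by
  have hTc := D.continuous_transportInv hg hgM
  have hT := integrable_of_norm_le_mul hM hTc (D.norm_transportInv_le_mul hgM)
  have hgi := integrable_of_norm_le_mul hM hg hgM
  have hνT : Integrable (fun v => ν v • transportInv ν E g v) μ :=
    hT.bdd_smul ν₂ D.continuous_freq.aestronglyMeasurable
      (Eventually.of_forall fun v => by
        rw [Real.norm_eq_abs, abs_of_nonneg]
        · exact hν v
        · linarith [D.le_freq v, D.rate_pos])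
  have h := integral_bilinear_hasLineDerivAt_right_eq_neg_left_of_integrable (μ := μ)
    (f := fun _ : V => (1 : ℝ)) (f' := fun _ => 0) (g := transportInv ν E g)
    (g' := fun v => g v - ν v • transportInv ν E g v) (v := E)
    (B := ContinuousLinearMap.lsmul ℝ ℝ)
    (by simp) (by simpa [Pi.sub_def] using hgi.sub hνT) (by simpa using hT)
    (fun x _ => by simpa [HasLineDerivAt] using hasDerivAt_const (0 : ℝ) (1 : ℝ))
    (fun x _ => D.hasLineDerivAt_transportInv hg hgM x)
  simp only [ContinuousLinearMap.lsmul_apply, one_smul, zero_smul, integral_zero, neg_zero] at h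
  rw [integral_sub hgi hνT] at h
  exact (sub_eq_zero.1 h).symm

end DampedTransport

end Transport

/-! ### The equilibrium `M` and the collision kernel -/

section Equilibrium

variable {d : ℕ} {α : ℝ} {M : EuclideanSpace ℝ (Fin d) → ℝ}

namespace HeavyTailEquilibrium

variable (hM : HeavyTailEquilibrium α M)
include hM

theorem continuous : Continuous M := hM.differentiable.continuous

theorem integrable : Integrable M := integrable_of_integral_eq_one hM.integral_eq_one

/-- Outside a large ball the limit `γ` controls the product, and on the ball compactness does. The
base `1 + ‖v‖` makes the two-sided bound valid up to the origin. -/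
theorem tail_bounds : ∃ a b : ℝ, 0 < a ∧ ∀ v, a ≤ (1 + ‖v‖) ^ ((d : ℝ) + α) * M v ∧
    (1 + ‖v‖) ^ ((d : ℝ) + α) * M v ≤ b := by
  obtain ⟨γ, hγ, hlim⟩ := hM.tail
  have hp : 0 ≤ (d : ℝ) + α := by linarith [hM.one_le_alpha, (Nat.cast_nonneg d : (0 : ℝ) ≤ d)]
  set p := (d : ℝ) + α
  have hev : ∀ᶠ v in Bornology.cobounded (EuclideanSpace ℝ (Fin d)),
      γ / 2 ≤ ‖v‖ ^ p * M v ∧ ‖v‖ ^ p * M v ≤ 2 * γ :=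
    (hlim.eventually_const_le (by linarith)).and (hlim.eventually_le_const (by linarith))
  obtain ⟨R, -, hR⟩ := (hasBasis_cobounded_norm.eventually_iff).1 hev
  have hcont : Continuous fun v => (1 + ‖v‖) ^ p * M v := by
    refine Continuous.mul (Continuous.rpow_const (by fun_prop) fun v => Or.inr hp) hM.continuous
  have hpos : ∀ v, 0 < (1 + ‖v‖) ^ p * M v := fun v => by
    have := hM.pos v
    positivity
  have hK := isCompact_closedBall (0 : EuclideanSpace ℝ (Fin d)) (max R 1)
  have hKne : (Metric.closedBall (0 : EuclideanSpace ℝ (Fin d)) (max R 1)).Nonempty :=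
    ⟨0, by simp⟩
  obtain ⟨x, -, hx⟩ := hK.exists_isMinOn hKne hcont.continuousOn
  obtain ⟨y, -, hy⟩ := hK.exists_isMaxOn hKne hcont.continuousOn
  refine ⟨min (γ / 2) ((1 + ‖x‖) ^ p * M x), max (2 ^ p * (2 * γ)) ((1 + ‖y‖) ^ p * M y),
    lt_min (by linarith) (hpos x), fun v => ?_⟩
  by_cases hv : v ∈ Metric.closedBall (0 : EuclideanSpace ℝ (Fin d)) (max R 1)
  · exact ⟨(min_le_right _ _).trans (hx hv), (hy hv).trans (le_max_right _ _)⟩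
  · rw [mem_closedBall_zero_iff, not_le, max_lt_iff] at hv
    obtain ⟨h1, h2⟩ := hR (x := v) hv.1.le
    have hMv := (hM.pos v).le
    constructor
    · refine (min_le_left _ _).trans (h1.trans ?_)
      gcongr
      linarith
    · refine le_trans ?_ (le_max_left _ _)
      calc (1 + ‖v‖) ^ p * M v ≤ (2 * ‖v‖) ^ p * M v := by
            gcongr
            linarith
        _ = 2 ^ p * (‖v‖ ^ p * M v) := by
            rw [Real.mul_rpow (by norm_num) (norm_nonneg v)]; ring
        _ ≤ 2 ^ p * (2 * γ) := by gcongr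

theorem bounded : ∃ B, ∀ v, M v ≤ B := by
  obtain ⟨a, b, -, h⟩ := hM.tail_bounds
  have hp : 0 ≤ (d : ℝ) + α := by linarith [hM.one_le_alpha, (Nat.cast_nonneg d : (0 : ℝ) ≤ d)]
  refine ⟨b, fun v => le_trans ?_ (h v).2⟩
  refine le_mul_of_one_le_left (hM.pos v).le (Real.one_le_rpow ?_ hp)
  linarith [norm_nonneg v]

/-- The equilibrium grows at most exponentially under translations, at any positive rate. -/
theorem translate_le {ε : ℝ} (hε : 0 < ε) :
    ∃ A : ℝ, ∀ v w, M (v + w) ≤ A * Real.exp (ε * ‖w‖) * M v := by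
  obtain ⟨a, b, ha, hab⟩ := hM.tail_bounds
  have hp : 0 ≤ (d : ℝ) + α := by linarith [hM.one_le_alpha, (Nat.cast_nonneg d : (0 : ℝ) ≤ d)]
  set p := (d : ℝ) + α
  obtain ⟨n, hn⟩ := exists_nat_ge p
  have hb : 0 < b := ha.trans_le ((hab 0).1.trans (hab 0).2)
  -- The ratio `b / a` compares `M` with the power law; the rest comes from `xⁿ / n! ≤ exp x` at `x
  -- = ε (1 + ‖w‖)`.
  refine ⟨b / a * (n.factorial / ε ^ n * Real.exp ε), fun v w => ?_⟩
  have hpow : (1 + ‖w‖) ^ p ≤ n.factorial / ε ^ n * Real.exp ε * Real.exp (ε * ‖w‖) := by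
    calc (1 + ‖w‖) ^ p ≤ (1 + ‖w‖) ^ (n : ℝ) :=
          Real.rpow_le_rpow_of_exponent_le (by linarith [norm_nonneg w]) hn
      _ = n.factorial / ε ^ n * ((ε * (1 + ‖w‖)) ^ n / n.factorial) := by
          rw [Real.rpow_natCast, mul_pow]
          field_simp
      _ ≤ n.factorial / ε ^ n * Real.exp (ε * (1 + ‖w‖)) := by
          gcongr
          exact Real.pow_div_factorial_le_exp _ (by positivity) n
      _ = _ := by rw [mul_assoc, ← Real.exp_add]; ring_nf
  -- Peetre's inequality: a translation by `w` costs at most the factor `(1 + ‖w‖) ^ p`.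
  have hpeetre : (1 + ‖v‖) ^ p ≤ (1 + ‖w‖) ^ p * (1 + ‖v + w‖) ^ p := by
    rw [← Real.mul_rpow (by positivity) (by positivity)]
    refine Real.rpow_le_rpow (by positivity) ?_ hp
    have : ‖v‖ ≤ ‖v + w‖ + ‖w‖ := by simpa using norm_sub_le (v + w) w
    nlinarith [norm_nonneg w, norm_nonneg (v + w)]
  have hv : 0 < (1 + ‖v‖) ^ p := by positivity
  have hMv := hM.pos v
  have hMw := hM.pos (v + w)
  refine le_of_mul_le_mul_left ?_ hv
  calc (1 + ‖v‖) ^ p * M (v + w) ≤ (1 + ‖w‖) ^ p * (1 + ‖v + w‖) ^ p * M (v + w) := by gcongr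
    _ = (1 + ‖w‖) ^ p * ((1 + ‖v + w‖) ^ p * M (v + w)) := by ring
    _ ≤ (1 + ‖w‖) ^ p * b := by gcongr; exact (hab _).2
    _ = b / a * (1 + ‖w‖) ^ p * a := by field_simp
    _ ≤ b / a * (n.factorial / ε ^ n * Real.exp ε * Real.exp (ε * ‖w‖)) *
        ((1 + ‖v‖) ^ p * M v) := by
        gcongr
        exact (hab v).1
    _ = _ := by ring

end HeavyTailEquilibrium

/-- A continuous symmetric kernel with `0 < ν₁ ≤ σ ≤ ν₂`, together with a continuous positive
probability density. -/
structure CollisionKernel (σ : EuclideanSpace ℝ (Fin d) → EuclideanSpace ℝ (Fin d) → ℝ)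
    (M : EuclideanSpace ℝ (Fin d) → ℝ) (ν₁ ν₂ : ℝ) : Prop where
  continuous_kernel : Continuous (Function.uncurry σ)
  symm : ∀ v v', σ v v' = σ v' v
  pos : 0 < ν₁
  lower : ∀ v v', ν₁ ≤ σ v v'
  upper : ∀ v v', σ v v' ≤ ν₂
  continuous_weight : Continuous M
  weight_pos : ∀ v, 0 < M v
  integrable_weight : Integrable M
  integral_weight : ∫ v, M v = 1

variable {σ : EuclideanSpace ℝ (Fin d) → EuclideanSpace ℝ (Fin d) → ℝ}

/-- The gradient bound makes `σ` Lipschitz in each variable with one constant, hence jointly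
continuous; this supplies the measurability needed for Fubini. -/
theorem AdmissibleCrossSection.exists_collisionKernel (hM : HeavyTailEquilibrium α M)
    (hσ : AdmissibleCrossSection M σ) : ∃ ν₁ ν₂, CollisionKernel σ M ν₁ ν₂ := by
  obtain ⟨ν₁, ν₂, hpos, hb⟩ := hσ.bounds
  obtain ⟨C, hC⟩ := hσ.fderiv_bound
  have hC0 : 0 ≤ C := by simpa using (norm_nonneg _).trans (hC 0 0)
  have hlip : ∀ v', LipschitzWith C.toNNReal (σ v') := fun v' =>
    lipschitzWith_of_nnnorm_fderiv_le (hσ.differentiable v') fun v => by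
      rw [← NNReal.coe_le_coe, coe_nnnorm, Real.coe_toNNReal _ hC0]
      refine (hC v' v).trans (div_le_self hC0 ?_)
      linarith [norm_nonneg v]
  have hcont : Continuous (Function.uncurry σ) :=
    (LipschitzWith.uncurry (fun v => by simpa only [hσ.symm _ v] using hlip v) hlip).continuous
  exact ⟨ν₁, ν₂, hcont, hσ.symm, hpos, fun v v' => (hb v v').1, fun v v' => (hb v v').2,
    hM.continuous, hM.pos, hM.integrable, hM.integral_eq_one⟩

/-- The average `∫ (σ(v, v') - c) f(v') dv'`. -/
noncomputable def kernelAverage {H : Type*} [NormedAddCommGroup H] [NormedSpace ℝ H]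
    (σ : EuclideanSpace ℝ (Fin d) → EuclideanSpace ℝ (Fin d) → ℝ) (c : ℝ)
    (f : EuclideanSpace ℝ (Fin d) → H) (v : EuclideanSpace ℝ (Fin d)) : H :=
  ∫ v', (σ v v' - c) • f v'

namespace CollisionKernel

variable {ν₁ ν₂ : ℝ} (K : CollisionKernel σ M ν₁ ν₂)
  {H : Type*} [NormedAddCommGroup H] [NormedSpace ℝ H] {f g : EuclideanSpace ℝ (Fin d) → H}
include K

theorem lower_le_upper : ν₁ ≤ ν₂ := (K.lower 0 0).trans (K.upper 0 0)

theorem abs_le (v v') : |σ v v'| ≤ ν₂ := by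
  rw [abs_of_nonneg (K.pos.le.trans (K.lower v v'))]
  exact K.upper v v'

theorem abs_sub_le (v v') : |σ v v' - ν₁| ≤ ν₂ - ν₁ := by
  rw [abs_of_nonneg (sub_nonneg.2 (K.lower v v'))]
  linarith [K.upper v v']

theorem continuous_right (v) : Continuous (σ v) := by
  have := K.continuous_kernel.comp (Continuous.prodMk_right v)
  exact this

theorem continuous_left (v') : Continuous fun v => σ v v' := by
  simpa only [K.symm _ v'] using K.continuous_right v'

theorem integrable_kernel_smul (hf : Integrable f) (v) : Integrable fun v' => σ v v' • f v' :=
  hf.bdd_smul ν₂ (K.continuous_right v).aestronglyMeasurable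
    (Eventually.of_forall fun v' => K.abs_le v v')

theorem integrable_kernel_sub_smul (hf : Integrable f) (c : ℝ) (v) :
    Integrable fun v' => (σ v v' - c) • f v' := by
  simpa only [sub_smul, Pi.sub_def, Pi.smul_def] using
    (K.integrable_kernel_smul hf v).sub (hf.smul c)

theorem collisionFreq_eq (v) : collisionFreq σ M v = ∫ v', σ v v' * M v' := by
  simp only [collisionFreq, K.symm _ v]

theorem le_collisionFreq (v) : ν₁ ≤ collisionFreq σ M v := by
  rw [K.collisionFreq_eq]
  calc ν₁ = ∫ v', ν₁ * M v' := by rw [integral_const_mul, K.integral_weight, mul_one]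
    _ ≤ _ := integral_mono (K.integrable_weight.const_mul _)
        (K.integrable_kernel_smul K.integrable_weight v)
        fun v' => mul_le_mul_of_nonneg_right (K.lower v v') (K.weight_pos v').le

theorem collisionFreq_le (v) : collisionFreq σ M v ≤ ν₂ := by
  rw [K.collisionFreq_eq]
  calc _ ≤ ∫ v', ν₂ * M v' := integral_mono (K.integrable_kernel_smul K.integrable_weight v)
        (K.integrable_weight.const_mul _)
        fun v' => mul_le_mul_of_nonneg_right (K.upper v v') (K.weight_pos v').le
    _ = ν₂ := by rw [integral_const_mul, K.integral_weight, mul_one]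

theorem abs_collisionFreq_le (v) : |collisionFreq σ M v| ≤ ν₂ := by
  rw [abs_of_nonneg (K.pos.le.trans (K.le_collisionFreq v))]
  exact K.collisionFreq_le v

theorem continuous_kernelAverage (hf : Integrable f) (c : ℝ) :
    Continuous (kernelAverage σ c f) := by
  refine continuous_of_dominated (bound := fun v' => (ν₂ + |c|) * ‖f v'‖)
    (fun v => (K.integrable_kernel_sub_smul hf c v).aestronglyMeasurable)
    (fun v => Eventually.of_forall fun v' => ?_) (hf.norm.const_mul _)
    (Eventually.of_forall fun v' => ?_)
  · rw [norm_smul]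
    gcongr
    exact (norm_sub_le _ _).trans (add_le_add (K.abs_le v v') le_rfl)
  · have := K.continuous_left v'
    fun_prop

theorem continuous_collisionFreq : Continuous (collisionFreq σ M) := by
  have h := K.continuous_kernelAverage K.integrable_weight 0
  refine h.congr fun v => ?_
  simp [kernelAverage, K.collisionFreq_eq]

/-- The splitting `σ = ν₁ + (σ - ν₁)`: the constant part acts only through the total mass. -/
theorem kernelAverage_zero_eq (hf : Integrable f) (v) :
    kernelAverage σ 0 f v = kernelAverage σ ν₁ f v + ν₁ • ∫ v', f v' := by
  rw [kernelAverage, kernelAverage, ← integral_smul,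
    ← integral_add (K.integrable_kernel_sub_smul hf _ v) (hf.fun_smul _)]
  simp only [sub_zero, sub_smul, sub_add_cancel]

theorem kernelAverage_sub (hf : Integrable f) (hg : Integrable g) (c : ℝ) (v) :
    kernelAverage σ c (fun w => f w - g w) v = kernelAverage σ c f v - kernelAverage σ c g v := by
  rw [kernelAverage, kernelAverage, kernelAverage,
    ← integral_sub (K.integrable_kernel_sub_smul hf c v) (K.integrable_kernel_sub_smul hg c v)]
  simp only [smul_sub]

theorem boltzmannQ_eq [CompleteSpace H] (hf : Integrable f) (v) :
    boltzmannQ σ M f v = M v • kernelAverage σ 0 f v - collisionFreq σ M v • f v := by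
  rw [boltzmannQ, integral_sub, integral_smul_const]
  · congr 1
    simp only [kernelAverage, ← integral_smul, smul_smul, mul_comm, sub_zero]
  · simpa only [smul_smul, mul_comm] using (K.integrable_kernel_smul hf v).fun_smul (M v)
  · have := K.integrable_kernel_smul K.integrable_weight v
    simp only [K.symm _ v]
    exact this.smul_const (f v)

theorem norm_kernelAverage_le (f : EuclideanSpace ℝ (Fin d) → H) (v) :
    ‖kernelAverage σ ν₁ f v‖ ≤ kernelAverage σ ν₁ (fun w => ‖f w‖) v := by
  refine (norm_integral_le_integral_norm _).trans_eq ?_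
  simp only [norm_smul, Real.norm_eq_abs, abs_of_nonneg (sub_nonneg.2 (K.lower _ _)),
    kernelAverage, smul_eq_mul]

theorem norm_kernelAverage_le_mul (hf : Integrable f) (v) :
    ‖kernelAverage σ ν₁ f v‖ ≤ (ν₂ - ν₁) * ∫ v', ‖f v'‖ := by
  rw [← integral_const_mul]
  refine norm_integral_le_of_norm_le (hf.norm.const_mul _) (Eventually.of_forall fun v' => ?_)
  rw [norm_smul]
  gcongr
  exact K.abs_sub_le v v'

theorem kernelAverage_nonneg {f : EuclideanSpace ℝ (Fin d) → ℝ} (hf : ∀ᵐ v, 0 ≤ f v) (v) :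
    0 ≤ kernelAverage σ ν₁ f v :=
  integral_nonneg_of_ae (hf.mono fun v' h => mul_nonneg (sub_nonneg.2 (K.lower v v')) h)

theorem kernelAverage_mono {f g : EuclideanSpace ℝ (Fin d) → ℝ} (hf : Integrable f)
    (hg : Integrable g) (h : ∀ᵐ v, f v ≤ g v) (v) :
    kernelAverage σ ν₁ f v ≤ kernelAverage σ ν₁ g v := by
  have h1 := K.kernelAverage_nonneg (f := fun w => g w - f w) (h.mono fun _ h => sub_nonneg.2 h) v
  rw [K.kernelAverage_sub hg hf] at h1
  linarith

theorem integrable_freq_smul (hf : Integrable f) :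
    Integrable fun v => collisionFreq σ M v • f v :=
  hf.bdd_smul ν₂ K.continuous_collisionFreq.aestronglyMeasurable
    (Eventually.of_forall fun v => K.abs_collisionFreq_le v)

theorem integrable_weight_smul_kernelAverage (hf : Integrable f) :
    Integrable fun v => M v • kernelAverage σ ν₁ f v := by
  refine (K.integrable_weight.mul_const ((ν₂ - ν₁) * ∫ v', ‖f v'‖)).mono'
    (K.continuous_weight.smul (K.continuous_kernelAverage hf _)).aestronglyMeasurable
    (Eventually.of_forall fun v => ?_)
  rw [norm_smul, Real.norm_eq_abs, abs_of_pos (K.weight_pos v)]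
  exact mul_le_mul_of_nonneg_left (K.norm_kernelAverage_le_mul hf v) (K.weight_pos v).le

/-- Mass balance of the gain operator. -/
theorem integral_weight_smul_kernelAverage [CompleteSpace H] (hf : Integrable f) :
    ∫ v, M v • kernelAverage σ ν₁ f v =
      (∫ v, collisionFreq σ M v • f v) - ν₁ • ∫ v, f v := by
  -- After Fubini, integrating `(σ - ν₁) M` in the first variable gives `ν - ν₁`, by symmetry of `σ`
  -- and unit mass of `M`.
  have hprod : Integrable (fun p : EuclideanSpace ℝ (Fin d) × EuclideanSpace ℝ (Fin d) =>
      (σ p.1 p.2 - ν₁) • M p.1 • f p.2) (volume.prod volume) :=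
    (K.integrable_weight.smul_prod hf).bdd_smul (ν₂ - ν₁)
      (K.continuous_kernel.sub continuous_const).aestronglyMeasurable
      (Eventually.of_forall fun p => K.abs_sub_le p.1 p.2)
  calc ∫ v, M v • kernelAverage σ ν₁ f v
      = ∫ v, ∫ v', (σ v v' - ν₁) • M v • f v' := by
        simp only [kernelAverage, ← integral_smul, smul_comm (M _)]
    _ = ∫ v', ∫ v, (σ v v' - ν₁) • M v • f v' := integral_integral_swap hprod
    _ = ∫ v', (collisionFreq σ M v' • f v' - ν₁ • f v') := by
        refine integral_congr_ae (Eventually.of_forall fun v' => ?_)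
        simp only [smul_smul, integral_smul_const]
        rw [← sub_smul]
        congr 1
        simp only [K.symm _ v']
        have h := K.kernelAverage_zero_eq K.integrable_weight v'
        rw [K.integral_weight] at h
        simp only [kernelAverage, smul_eq_mul, mul_one, sub_zero] at h
        rw [K.collisionFreq_eq, h]
        ring
    _ = _ := by
        rw [integral_sub (K.integrable_freq_smul hf) (hf.fun_smul _), integral_smul]

end CollisionKernel

end Equilibrium

/-! ### Stationary solutions by a fixed point -/

section Stationary

open scoped BoundedContinuousFunction

variable {d : ℕ} {M : EuclideanSpace ℝ (Fin d) → ℝ}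
  {σ : EuclideanSpace ℝ (Fin d) → EuclideanSpace ℝ (Fin d) → ℝ}

/-- Subexponential growth of `M` at the rate `ν₁ / 2 / (|R| + 1)` per unit length is at most the
rate `ν₁ / 2` per unit of the line parameter when `‖E‖ ≤ R`. The constant `A` is uniform in such
`E`, which the final estimate needs. -/
theorem CollisionKernel.exists_dampedTransport {α ν₁ ν₂ : ℝ} (K : CollisionKernel σ M ν₁ ν₂)
    (hM : HeavyTailEquilibrium α M) (R : ℝ) :
    ∃ A, ∀ E : EuclideanSpace ℝ (Fin d), ‖E‖ ≤ R →
      DampedTransport (collisionFreq σ M) M E (ν₁ / 2) A := by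
  have hR : 0 < |R| + 1 := by positivity
  have hK := K.pos
  obtain ⟨A, hA⟩ := hM.translate_le (ε := ν₁ / 2 / (|R| + 1)) (by positivity)
  have hA0 : 0 ≤ A := by
    have h := (hM.pos (0 + 0)).le.trans (hA 0 0)
    simp only [norm_zero, mul_zero, Real.exp_zero, mul_one] at h
    exact nonneg_of_mul_nonneg_left h (hM.pos 0)
  refine ⟨A, fun E hE => ⟨K.continuous_collisionFreq, K.continuous_weight, by linarith,
    fun v => by linarith [K.le_collisionFreq v], K.weight_pos, hM.bounded, fun v x hx => ?_⟩⟩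
  refine (hA v (x • E)).trans ?_
  have hMv := (K.weight_pos v).le
  gcongr
  rw [norm_smul, Real.norm_eq_abs, abs_of_nonpos hx]
  have h1 : -x * ‖E‖ ≤ -x * (|R| + 1) :=
    mul_le_mul_of_nonneg_left (by linarith [le_abs_self R]) (by linarith)
  calc ν₁ / 2 / (|R| + 1) * (-x * ‖E‖) ≤ ν₁ / 2 / (|R| + 1) * (-x * (|R| + 1)) := by gcongr
    _ = -(ν₁ / 2 * x) := by field_simp

namespace CollisionKernel

variable {ν₁ ν₂ : ℝ} (K : CollisionKernel σ M ν₁ ν₂) {E : EuclideanSpace ℝ (Fin d)} {c A : ℝ}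
  (D : DampedTransport (collisionFreq σ M) M E c A)
  {H : Type*} [NormedAddCommGroup H] [NormedSpace ℝ H]

include K in
theorem norm_weight_smul_le {b : EuclideanSpace ℝ (Fin d) → H} {B : ℝ} (hb : ∀ v, ‖b v‖ ≤ B) (v) :
    ‖M v • b v‖ ≤ B * M v := by
  rw [norm_smul, Real.norm_eq_abs, abs_of_pos (K.weight_pos v), mul_comm]
  exact mul_le_mul_of_nonneg_right (hb v) (K.weight_pos v).le

include K D in
theorem integrable_transportInv {g : EuclideanSpace ℝ (Fin d) → H} {B : ℝ} (hg : Continuous g)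
    (hgM : ∀ v, ‖g v‖ ≤ B * M v) :
    Integrable (transportInv (collisionFreq σ M) E g) :=
  integrable_of_norm_le_mul K.integrable_weight (D.continuous_transportInv hg hgM)
    (D.norm_transportInv_le_mul hgM)

-- A priori `L¹` bound. Multiplying by `ν` and integrating, the two mass balances turn the right
-- side into `κ + ∫ ν ‖f‖ - ν₁ ∫ ‖f‖`, and `∫ ν ‖f‖` cancels.
omit [NormedSpace ℝ H] in
include K D in
theorem integral_norm_le_of_norm_le_transportInv {f : EuclideanSpace ℝ (Fin d) → H} {κ : ℝ}
    (hκ : 0 ≤ κ) (hf : Integrable f)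
    (h : ∀ v, ‖f v‖ ≤ transportInv (collisionFreq σ M) E
      (fun w => M w • (κ + kernelAverage σ ν₁ (fun w => ‖f w‖) w)) v) :
    ν₁ * ∫ v, ‖f v‖ ≤ κ := by
  have hKc := K.continuous_kernelAverage hf.norm ν₁
  have hg : Continuous fun w => M w • (κ + kernelAverage σ ν₁ (fun w => ‖f w‖) w) := by
    have := K.continuous_weight
    fun_prop
  have hgM : ∀ v, ‖M v • (κ + kernelAverage σ ν₁ (fun w => ‖f w‖) v)‖ ≤
      (κ + (ν₂ - ν₁) * ∫ v, ‖f v‖) * M v := K.norm_weight_smul_le fun v => by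
    refine (norm_add_le _ _).trans (add_le_add ?_ ?_)
    · rw [Real.norm_eq_abs, abs_of_nonneg hκ]
    · simpa using K.norm_kernelAverage_le_mul hf.norm v
  have h1 := D.integral_freq_smul_transportInv (μ := volume) K.integrable_weight
    K.collisionFreq_le hg hgM
  have h2 : ∫ v, collisionFreq σ M v • ‖f v‖ ≤ ∫ v, collisionFreq σ M v •
      transportInv (collisionFreq σ M) E
        (fun w => M w • (κ + kernelAverage σ ν₁ (fun w => ‖f w‖) w)) v :=
    integral_mono (K.integrable_freq_smul hf.norm)
      (K.integrable_freq_smul (K.integrable_transportInv D hg hgM)) fun v =>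
      mul_le_mul_of_nonneg_left (h v) (K.pos.le.trans (K.le_collisionFreq v))
  have h3 : ∫ v, M v • (κ + kernelAverage σ ν₁ (fun w => ‖f w‖) v) =
      κ + ((∫ v, collisionFreq σ M v • ‖f v‖) - ν₁ • ∫ v, ‖f v‖) := by
    rw [← K.integral_weight_smul_kernelAverage hf.norm]
    simp only [smul_add]
    rw [integral_add (K.integrable_weight.smul_const κ)
      (K.integrable_weight_smul_kernelAverage hf.norm), integral_smul_const, K.integral_weight,
      one_smul]
  rw [h1, h3, smul_eq_mul] at h2
  linarith

/-- The average of the solution of the transport equation with right-hand side `M b`. -/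
noncomputable def averagedTransport (b : EuclideanSpace ℝ (Fin d) →ᵇ H) :
    EuclideanSpace ℝ (Fin d) →ᵇ H :=
  BoundedContinuousFunction.ofNormedAddCommGroup
    (kernelAverage σ ν₁ (transportInv (collisionFreq σ M) E fun w => M w • b w))
    (K.continuous_kernelAverage (K.integrable_transportInv D
      (K.continuous_weight.smul b.continuous) (K.norm_weight_smul_le b.norm_coe_le_norm)) _)
    _ (K.norm_kernelAverage_le_mul (K.integrable_transportInv D
      (K.continuous_weight.smul b.continuous) (K.norm_weight_smul_le b.norm_coe_le_norm)))

omit [NormedSpace ℝ H] in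
include K in
theorem integrable_weight_mul_norm (b : EuclideanSpace ℝ (Fin d) →ᵇ H) :
    Integrable fun v => M v * ‖b v‖ :=
  integrable_of_norm_le_mul K.integrable_weight
    (by have := K.continuous_weight; fun_prop)
    (K.norm_weight_smul_le (b := fun v => ‖b v‖) (B := ‖b‖)
      fun v => by simpa using b.norm_coe_le_norm v)

/-- With `u` the transport solution for the source `M ‖b - b'‖`, the mass `N` of that source equals
`∫ ν u`. The first bound is `N - ν₁ ∫ u` with `N ≤ ν₂ ∫ u`; the second uses `σ - ν₁ ≤ ν₂ - ν₁` and
`ν₁ ∫ u ≤ N`. -/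
theorem averagedTransport_sub_le (b b' : EuclideanSpace ℝ (Fin d) →ᵇ H) :
    (∫ v, M v * ‖(K.averagedTransport D b - K.averagedTransport D b') v‖ ≤
      (1 - ν₁ / ν₂) * ∫ v, M v * ‖(b - b') v‖) ∧
    ‖K.averagedTransport D b - K.averagedTransport D b'‖ ≤
      (ν₂ - ν₁) / ν₁ * ∫ v, M v * ‖(b - b') v‖ := by
  have hν₁ := K.pos
  have hν₂ : 0 < ν₂ := hν₁.trans_le K.lower_le_upper
  have hbc : ∀ b : EuclideanSpace ℝ (Fin d) →ᵇ H, Continuous fun w => M w • b w := fun b =>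
    K.continuous_weight.smul b.continuous
  have hbM := fun b : EuclideanSpace ℝ (Fin d) →ᵇ H => K.norm_weight_smul_le b.norm_coe_le_norm
  have hTi := fun b : EuclideanSpace ℝ (Fin d) →ᵇ H => K.integrable_transportInv D (hbc b) (hbM b)
  have hgc : Continuous fun w => M w * ‖(b - b') w‖ :=
    K.continuous_weight.mul (b - b').continuous.norm
  have hgM : ∀ w, ‖M w * ‖(b - b') w‖‖ ≤ ‖b - b'‖ * M w :=
    K.norm_weight_smul_le (b := fun v => ‖(b - b') v‖)
      fun v => by simpa only [norm_norm] using (b - b').norm_coe_le_norm v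
  set u := transportInv (collisionFreq σ M) E fun w => M w * ‖(b - b') w‖ with hu
  have hui : Integrable u := K.integrable_transportInv D hgc hgM
  have hu0 : ∀ v, 0 ≤ u v := DampedTransport.transportInv_nonneg fun w =>
    mul_nonneg (K.weight_pos w).le (norm_nonneg _)
  have hνu : ∫ v, collisionFreq σ M v • u v = ∫ v, M v * ‖(b - b') v‖ :=
    D.integral_freq_smul_transportInv (μ := volume) K.integrable_weight K.collisionFreq_le hgc hgM
  have hle : ∀ v, ‖(K.averagedTransport D b - K.averagedTransport D b') v‖ ≤
      kernelAverage σ ν₁ u v := fun v => by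
    have h1 : (K.averagedTransport D b - K.averagedTransport D b') v =
        kernelAverage σ ν₁ (transportInv (collisionFreq σ M) E fun w => M w • (b - b') w) v := by
      rw [BoundedContinuousFunction.sub_apply]
      refine (K.kernelAverage_sub (hTi b) (hTi b') ν₁ v).symm.trans ?_
      congr 1
      funext w
      rw [← D.transportInv_sub (hbc b) (hbM b) (hbc b') (hbM b')]
      simp only [← smul_sub, BoundedContinuousFunction.sub_apply]
    rw [h1]
    refine (K.norm_kernelAverage_le _ v).trans (K.kernelAverage_mono (hTi _).norm hui
      (Eventually.of_forall fun w => (DampedTransport.norm_transportInv_le _ w).trans_eq ?_) v)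
    simp only [norm_smul, Real.norm_eq_abs, abs_of_pos (K.weight_pos _), hu]
  have hu1 : ν₁ * ∫ v, u v ≤ ∫ v, M v * ‖(b - b') v‖ := by
    rw [← hνu, ← integral_const_mul]
    exact integral_mono (hui.const_mul _) (K.integrable_freq_smul hui) fun v =>
      mul_le_mul_of_nonneg_right (K.le_collisionFreq v) (hu0 v)
  have hu2 : ∫ v, M v * ‖(b - b') v‖ ≤ ν₂ * ∫ v, u v := by
    rw [← hνu, ← integral_const_mul]
    exact integral_mono (K.integrable_freq_smul hui) (hui.const_mul _) fun v =>
      mul_le_mul_of_nonneg_right (K.collisionFreq_le v) (hu0 v)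
  constructor
  · calc _ ≤ ∫ v, M v • kernelAverage σ ν₁ u v :=
          integral_mono (K.integrable_weight_mul_norm _)
            (K.integrable_weight_smul_kernelAverage hui)
            fun v => mul_le_mul_of_nonneg_left (hle v) (K.weight_pos v).le
      _ = (∫ v, M v * ‖(b - b') v‖) - ν₁ / ν₂ * (ν₂ * ∫ v, u v) := by
          rw [K.integral_weight_smul_kernelAverage hui, hνu, smul_eq_mul]
          field_simp
      _ ≤ _ := by
          have : 0 ≤ ν₁ / ν₂ := by positivity
          nlinarith
  · have h0 : 0 ≤ (ν₂ - ν₁) / ν₁ := div_nonneg (sub_nonneg.2 K.lower_le_upper) hν₁.le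
    have hN : 0 ≤ ∫ v, M v * ‖(b - b') v‖ := integral_nonneg fun w =>
      mul_nonneg (K.weight_pos w).le (norm_nonneg _)
    refine (BoundedContinuousFunction.norm_le (by positivity)).2 fun v => (hle v).trans ?_
    refine (le_abs_self _).trans ((K.norm_kernelAverage_le_mul hui v).trans ?_)
    simp only [Real.norm_eq_abs, abs_of_nonneg (hu0 _)]
    calc (ν₂ - ν₁) * ∫ v, u v = (ν₂ - ν₁) / ν₁ * (ν₁ * ∫ v, u v) := by field_simp
      _ ≤ _ := by gcongr

/-- The map contracts in the norm `∫ M ‖b‖`, but completeness is available in the sup norm. Running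
`n` steps in the weak norm and one more step back to the sup norm makes the iterate of order `n + 1`
a sup-norm contraction; its fixed point is one of the map itself. -/
theorem exists_fixedPoint [CompleteSpace H] (s : EuclideanSpace ℝ (Fin d) →ᵇ H) :
    ∃ b, b = s + K.averagedTransport D b := by
  have hν₁ := K.pos
  have hν₂ : 0 < ν₂ := hν₁.trans_le K.lower_le_upper
  set Φ : (EuclideanSpace ℝ (Fin d) →ᵇ H) → (EuclideanSpace ℝ (Fin d) →ᵇ H) :=
    fun b => s + K.averagedTransport D b with hΦ
  have hq0 : 0 ≤ 1 - ν₁ / ν₂ := sub_nonneg.2 ((div_le_one hν₂).2 K.lower_le_upper)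
  have hq1 : 1 - ν₁ / ν₂ < 1 := by
    have : 0 < ν₁ / ν₂ := by positivity
    linarith
  set q := 1 - ν₁ / ν₂
  have h0 : 0 ≤ (ν₂ - ν₁) / ν₁ := div_nonneg (sub_nonneg.2 K.lower_le_upper) hν₁.le
  have hsub : ∀ b b', Φ b - Φ b' = K.averagedTransport D b - K.averagedTransport D b' :=
    fun b b' => add_sub_add_left_eq_sub _ _ _
  have hiter : ∀ n b b', ∫ v, M v * ‖(Φ^[n] b - Φ^[n] b') v‖ ≤ q ^ n * ‖b - b'‖ := by
    intro n b b'
    induction n with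
    | zero =>
      simp only [Function.iterate_zero, id, pow_zero, one_mul]
      calc ∫ v, M v * ‖(b - b') v‖ ≤ ∫ v, M v * ‖b - b'‖ :=
            integral_mono (K.integrable_weight_mul_norm _) (K.integrable_weight.mul_const _)
              fun v => mul_le_mul_of_nonneg_left ((b - b').norm_coe_le_norm v) (K.weight_pos v).le
        _ = ‖b - b'‖ := by rw [integral_mul_const, K.integral_weight, one_mul]
    | succ n ih =>
      rw [Function.iterate_succ_apply', Function.iterate_succ_apply', hsub]
      refine (K.averagedTransport_sub_le D _ _).1.trans ?_
      rw [pow_succ', mul_assoc]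
      gcongr
  have hlim : Tendsto (fun n => (ν₂ - ν₁) / ν₁ * q ^ n) atTop (𝓝 0) := by
    simpa using (tendsto_pow_atTop_nhds_zero_of_lt_one hq0 hq1).const_mul ((ν₂ - ν₁) / ν₁)
  obtain ⟨n, hn⟩ := (hlim.eventually (gt_mem_nhds one_pos)).exists
  have hcontr : ContractingWith ((ν₂ - ν₁) / ν₁ * q ^ n).toNNReal Φ^[n + 1] := by
    refine ⟨by simpa using hn, LipschitzWith.of_dist_le_mul fun b b' => ?_⟩
    rw [Real.coe_toNNReal _ (by positivity), dist_eq_norm, dist_eq_norm,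
      Function.iterate_succ_apply', Function.iterate_succ_apply', hsub, mul_assoc]
    refine (K.averagedTransport_sub_le D _ _).2.trans ?_
    gcongr
    exact hiter n b b'
  exact ⟨_, hcontr.isFixedPt_fixedPoint_iterate.symm⟩

include K D in
/-- Solvability of `E · ∇f + ν f = M (s + ∫ (σ - ν₁) f)`. -/
theorem exists_stationary [CompleteSpace H] (s : EuclideanSpace ℝ (Fin d) →ᵇ H) :
    ∃ f : EuclideanSpace ℝ (Fin d) → H, Continuous f ∧ (∃ B, ∀ v, ‖f v‖ ≤ B * M v) ∧
      (∀ v, f v = transportInv (collisionFreq σ M) E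
        (fun w => M w • (s w + kernelAverage σ ν₁ f w)) v) ∧
      (∀ v, HasLineDerivAt ℝ f (M v • (s v + kernelAverage σ ν₁ f v) -
        collisionFreq σ M v • f v) v E) ∧
      ν₁ • ∫ v, f v = ∫ v, M v • s v := by
  obtain ⟨b, hb⟩ := K.exists_fixedPoint D s
  have hbc : Continuous fun w => M w • b w := K.continuous_weight.smul b.continuous
  have hbM := K.norm_weight_smul_le b.norm_coe_le_norm
  set f := transportInv (collisionFreq σ M) E fun w => M w • b w with hf
  have hbs : ∀ w, b w = s w + kernelAverage σ ν₁ f w := fun w =>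
    congrArg (fun b : EuclideanSpace ℝ (Fin d) →ᵇ H => b w) hb
  have hfi : Integrable f := K.integrable_transportInv D hbc hbM
  refine ⟨f, D.continuous_transportInv hbc hbM, ⟨_, D.norm_transportInv_le_mul hbM⟩,
    fun v => by simp only [← hbs]; rfl, fun v => ?_, ?_⟩
  · rw [← hbs]
    exact D.hasLineDerivAt_transportInv hbc hbM v
  · have h := D.integral_freq_smul_transportInv (μ := volume) K.integrable_weight
      K.collisionFreq_le hbc hbM
    rw [← hf] at h
    simp only [hbs, smul_add] at h
    have hsi : Integrable fun v => M v • s v := integrable_of_norm_le_mul K.integrable_weight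
      (K.continuous_weight.smul s.continuous) (K.norm_weight_smul_le s.norm_coe_le_norm)
    rw [integral_add hsi (K.integrable_weight_smul_kernelAverage hfi),
      K.integral_weight_smul_kernelAverage hfi] at h
    have h2 : ν₁ • ∫ v, f v = (∫ v, M v • s v) + ((∫ v, collisionFreq σ M v • f v) -
        ν₁ • ∫ v, f v) - (∫ v, collisionFreq σ M v • f v) + ν₁ • ∫ v, f v := by
      rw [← h]; abel
    rw [h2]
    abel

include K D in
/-- The modified equilibrium: a positive solution of `E · ∇F = Q(F)` with unit mass. -/
theorem exists_modifiedEquilibrium :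
    ∃ F : EuclideanSpace ℝ (Fin d) → ℝ, Continuous F ∧ (∃ B, ∀ v, ‖F v‖ ≤ B * M v) ∧
      (∀ v, 0 < F v) ∧ (∀ v, HasLineDerivAt ℝ F (M v • kernelAverage σ 0 F v -
        collisionFreq σ M v • F v) v E) ∧ ∫ v, F v = 1 := by
  have hν₁ := K.pos
  obtain ⟨F, hFc, ⟨B, hB⟩, hFT, hFd, hFm⟩ :=
    -- The source `ν₁` stands for `ν₁ ∫ F`. It forces `ν₁ ∫ F = ν₁ ∫ M`, so the mass is one and the
    -- substitution is consistent.
    K.exists_stationary D (BoundedContinuousFunction.const _ ν₁)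
  have hFi : Integrable F := integrable_of_norm_le_mul K.integrable_weight hFc hB
  have hmass : ∫ v, F v = 1 := by
    simp only [BoundedContinuousFunction.const_apply, smul_eq_mul, integral_mul_const,
      K.integral_weight, one_mul] at hFm
    exact mul_left_cancel₀ hν₁.ne' (by rw [hFm, mul_one])
  simp only [BoundedContinuousFunction.const_apply] at hFT hFd
  have hcont : ∀ {f : EuclideanSpace ℝ (Fin d) → ℝ}, Integrable f →
      Continuous fun w => M w • (ν₁ + kernelAverage σ ν₁ f w) := fun hf =>
    K.continuous_weight.smul (continuous_const.add (K.continuous_kernelAverage hf _))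
  have hbd : ∀ {f : EuclideanSpace ℝ (Fin d) → ℝ}, Integrable f →
      ∀ w, ‖M w • (ν₁ + kernelAverage σ ν₁ f w)‖ ≤ (‖ν₁‖ + (ν₂ - ν₁) * ∫ v, ‖f v‖) * M w :=
    fun hf => K.norm_weight_smul_le fun w =>
      (norm_add_le _ _).trans (add_le_add le_rfl (K.norm_kernelAverage_le_mul hf w))
  have hnorm : ν₁ * ∫ v, ‖F v‖ ≤ ν₁ := by
    refine K.integral_norm_le_of_norm_le_transportInv D hν₁.le hFi fun v => ?_
    conv_lhs => rw [hFT]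
    refine (DampedTransport.norm_transportInv_le _ v).trans
      (D.transportInv_mono (hcont hFi).norm (fun w => by simpa only [norm_norm] using hbd hFi w)
        (hcont hFi.norm) (hbd hFi.norm) (fun w => ?_) v)
    rw [norm_smul, Real.norm_eq_abs, abs_of_pos (K.weight_pos w), smul_eq_mul]
    refine mul_le_mul_of_nonneg_left ((norm_add_le _ _).trans (add_le_add ?_ ?_))
      (K.weight_pos w).le
    · rw [Real.norm_eq_abs, abs_of_pos hν₁]
    · exact K.norm_kernelAverage_le F w
  -- Since `∫ |F| ≤ 1 = ∫ F`, the nonnegative function `|F| - F` has zero integral. Then `K F ≥ 0`,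
  -- and the source `M (ν₁ + K F)` is strictly positive everywhere.
  have hF0 : ∀ᵐ v, 0 ≤ F v := by
    have h1 : ∫ v, (‖F v‖ - F v) = 0 := by
      refine le_antisymm ?_ (integral_nonneg fun v => sub_nonneg.2 (le_abs_self _))
      rw [integral_sub hFi.norm hFi, hmass, sub_nonpos]
      exact le_of_mul_le_mul_left (by rwa [mul_one]) hν₁
    have h2 := (integral_eq_zero_iff_of_nonneg (fun v => sub_nonneg.2 (le_abs_self (F v)))
      (hFi.norm.sub hFi)).1 h1
    filter_upwards [h2] with v hv
    have : ‖F v‖ = F v := sub_eq_zero.1 hv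
    rw [← this]
    exact norm_nonneg _
  refine ⟨F, hFc, ⟨B, hB⟩, fun v => ?_, fun v => ?_, hmass⟩
  · rw [hFT]
    exact D.transportInv_pos (hcont hFi) (hbd hFi) (fun w => mul_pos (K.weight_pos w)
      (add_pos_of_pos_of_nonneg hν₁ (K.kernelAverage_nonneg hF0 w))) v
  · rw [K.kernelAverage_zero_eq hFi, hmass, smul_eq_mul ν₁, mul_one, add_comm]
    exact hFd v

end CollisionKernel

end Stationary

/-! ### Integrable weak solutions of the transport equation -/

section WeakTransport

variable {V : Type*} [NormedAddCommGroup V] [NormedSpace ℝ V] [FiniteDimensional ℝ V]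
  [MeasurableSpace V] [BorelSpace V] {μ : Measure V} [μ.IsAddHaarMeasure]

/-- Translations are continuous in `L¹`. -/
theorem tendsto_integral_norm_translate_sub {k : V → ℝ} (hk : Integrable k μ) (E : V) :
    Tendsto (fun τ : ℝ => ∫ v, ‖k (v + τ • E) - k v‖ ∂μ) (𝓝 0) (𝓝 0) := by
  have hk1 : MemLp k 1 μ := memLp_one_iff_integrable.2 hk
  let T : C(ℝ, C(V, V)) := (ContinuousMap.mk (fun p : ℝ × V => p.2 + p.1 • E) (by fun_prop)).curry
  have hT : ∀ τ, MeasurePreserving (T τ) μ μ := fun τ => measurePreserving_add_right μ (τ • E)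
  have hcont : Continuous fun τ => Lp.compMeasurePreserving (T τ) (hT τ) hk1.toLp :=
    continuous_const.compMeasurePreservingLp T.continuous hT ENNReal.one_ne_top
  have h0 := ((hcont.sub continuous_const).norm (f := fun τ =>
    Lp.compMeasurePreserving (T τ) (hT τ) hk1.toLp - hk1.toLp)).tendsto 0
  have heq : ∀ τ, ‖Lp.compMeasurePreserving (T τ) (hT τ) hk1.toLp - hk1.toLp‖ =
      ∫ v, ‖k (v + τ • E) - k v‖ ∂μ := fun τ => by
    rw [L1.norm_eq_integral_norm]
    refine integral_congr_ae ?_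
    filter_upwards [Lp.coeFn_sub (Lp.compMeasurePreserving (T τ) (hT τ) hk1.toLp) hk1.toLp,
      Lp.coeFn_compMeasurePreserving hk1.toLp (hT τ), hk1.coeFn_toLp,
      (hT τ).quasiMeasurePreserving.ae hk1.coeFn_toLp] with v h1 h2 h3 h4
    rw [h1, Pi.sub_apply, h2, h3, Function.comp, h4]
    rfl
  simp only [heq] at h0
  simpa using h0

/-- The shear `(τ, v) ↦ (τ, v + τE)` preserves the product measure. -/
theorem integrable_line_translate {k : V → ℝ} (hk : Integrable k μ) (E : V) (t : ℝ) :
    Integrable (fun p : ℝ × V => k (p.2 + p.1 • E))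
      ((volume.restrict (Set.Ioc 0 t)).prod μ) := by
  have hmp : MeasurePreserving (fun p : ℝ × V => (p.1, p.2 + p.1 • E))
      ((volume.restrict (Set.Ioc 0 t)).prod μ) ((volume.restrict (Set.Ioc 0 t)).prod μ) :=
    (MeasurePreserving.id _).skew_product (g := fun (τ : ℝ) (v : V) => v + τ • E)
      (by
        have : Continuous fun p : ℝ × V => p.2 + p.1 • E := by fun_prop
        exact this.measurable)
      (Eventually.of_forall fun τ => (measurePreserving_add_right μ (τ • E)).map_eq)
  exact hmp.integrable_comp_of_integrable (hk.comp_snd _)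

/-- An integrable weak solution of `E · ∇u = k` satisfies
`u(v + tE) - u(v) = ∫₀ᵗ k(v + τE) dτ`. -/
theorem translate_sub_eq_integral_of_weak {u k : V → ℝ} {E : V} (hu : Integrable u μ)
    (hk : Integrable k μ)
    (hw : ∀ φ : V → ℝ, ContDiff ℝ ∞ φ → HasCompactSupport φ →
      -∫ v, u v * fderiv ℝ φ v E ∂μ = ∫ v, k v * φ v ∂μ) {t : ℝ} (ht : 0 ≤ t) :
    ∀ᵐ v ∂μ, u (v + t • E) - u v = ∫ τ in (0 : ℝ)..t, k (v + τ • E) := by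
  have hki := integrable_line_translate hk E t
  have hut : Integrable (fun v => u (v + t • E)) μ := hu.comp_add_right _
  have hI : Integrable (fun v => ∫ τ in (0 : ℝ)..t, k (v + τ • E)) μ := by
    simp only [intervalIntegral.integral_of_le ht]
    exact hki.integral_prod_right
  have hmain : ∀ᵐ v ∂μ, u (v + t • E) - u v - ∫ τ in (0 : ℝ)..t, k (v + τ • E) = 0 := by
    refine ae_eq_zero_of_integral_contDiff_smul_eq_zero
      ((hut.sub hu).sub hI).locallyIntegrable fun φ hφ hφc => ?_
    obtain ⟨C, hC⟩ := hφc.exists_bound_of_continuous hφ.continuous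
    have hφ1 : Continuous (fderiv ℝ φ) := hφ.continuous_fderiv (by simp)
    obtain ⟨C', hC'⟩ := (hφc.fderiv (𝕜 := ℝ)).exists_bound_of_continuous hφ1
    have hφd : Differentiable ℝ φ := hφ.differentiable (by simp)
    have hmul : ∀ {f : V → ℝ}, Integrable f μ → ∀ s : ℝ,
        Integrable (fun v => f v * φ (v - s • E)) μ := fun hf s =>
      hf.mul_bdd (c := C) (by have := hφ.continuous; fun_prop) (Eventually.of_forall fun v => hC _)
    -- Translates of test functions are test functions, so the weak equation gives the derivative in
    -- `s` of `∫ u φ(· - sE)`. Integrating over `[0, t]` and moving the translation onto `u` and `k`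
    -- yields the identity tested against `φ`.
    have htest : ∀ s : ℝ, -∫ v, u v * fderiv ℝ φ (v - s • E) E ∂μ =
        ∫ v, k v * φ (v - s • E) ∂μ := fun s => by
      have h := hw (fun v => φ (v - s • E)) (hφ.comp (contDiff_id.sub contDiff_const))
        (hφc.comp_homeomorph (Homeomorph.subRight (s • E)))
      simpa only [fderiv_comp_sub] using h
    have hder : ∀ s : ℝ, HasDerivAt (fun s : ℝ => ∫ v, u v * φ (v - s • E) ∂μ)
        (∫ v, k v * φ (v - s • E) ∂μ) s := fun s => by
      have h := (hasDerivAt_integral_of_dominated_loc_of_deriv_le (μ := μ) (x₀ := s)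
        (s := Set.univ)
        (F := fun s v => u v * φ (v - s • E))
        (F' := fun s v => -(u v * fderiv ℝ φ (v - s • E) E))
        (bound := fun v => ‖u v‖ * (C' * ‖E‖)) univ_mem
        (Eventually.of_forall fun s => (hmul hu s).aestronglyMeasurable) (hmul hu s)
        (by
          have : Continuous fun v => fderiv ℝ φ (v - s • E) E := by fun_prop
          exact (hu.aestronglyMeasurable.mul this.aestronglyMeasurable).neg)
        (Eventually.of_forall fun v s _ => by
          rw [norm_neg, norm_mul]
          gcongr
          exact (ContinuousLinearMap.le_opNorm _ _).trans (by gcongr; exact hC' _))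
        (hu.norm.mul_const _)
        (Eventually.of_forall fun v s _ => by
          have h1 : HasDerivAt (fun s : ℝ => v - s • E) (-((1 : ℝ) • E)) s :=
            ((hasDerivAt_id s).smul_const E).const_sub v
          have h2 := ((hφd (v - s • E)).hasFDerivAt.comp_hasDerivAt s h1).const_mul (u v)
          refine h2.congr_deriv ?_
          simp)).2
      rw [integral_neg, htest] at h
      exact h
    have hcontD : Continuous fun s : ℝ => ∫ v, k v * φ (v - s • E) ∂μ := by
      refine continuous_of_dominated (bound := fun v => ‖k v‖ * C)
        (fun s => (hmul hk s).aestronglyMeasurable) (fun s => Eventually.of_forall fun v => ?_)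
        (hk.norm.mul_const _) (Eventually.of_forall fun v => ?_)
      · rw [norm_mul]
        gcongr
        exact hC _
      · have := hφ.continuous
        fun_prop
    have hFTC := intervalIntegral.integral_eq_sub_of_hasDerivAt (fun s _ => hder s)
      (hcontD.intervalIntegrable 0 t)
    have hshift : ∀ (f : V → ℝ) (s : ℝ), ∫ v, f v * φ (v - s • E) ∂μ =
        ∫ v, φ v * f (v + s • E) ∂μ := fun f s => by
      rw [← integral_add_right_eq_self _ (s • E)]
      simp only [add_sub_cancel_right, mul_comm]
    simp only [hshift] at hFTC
    simp only [zero_smul, add_zero] at hFTC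
    have hmul' : ∀ {f : V → ℝ}, Integrable f μ → Integrable (fun v => φ v * f v) μ := fun hf =>
      hf.bdd_mul (c := C) hφ.continuous.aestronglyMeasurable (Eventually.of_forall hC)
    have hswap : ∫ s in (0 : ℝ)..t, ∫ v, φ v * k (v + s • E) ∂μ =
        ∫ v, φ v * (∫ s in (0 : ℝ)..t, k (v + s • E)) ∂μ := by
      simp only [intervalIntegral.integral_of_le ht, ← integral_const_mul]
      refine integral_integral_swap ?_
      refine hki.bdd_mul (c := C) (f := fun p : ℝ × V => φ p.2) ?_
        (Eventually.of_forall fun p => hC _)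
      exact (hφ.continuous.comp continuous_snd).aestronglyMeasurable
    rw [hswap] at hFTC
    have hd : Integrable (fun v => φ v * u (v + t • E) - φ v * u v) μ := (hmul' hut).sub (hmul' hu)
    simp only [smul_eq_mul, mul_sub]
    rw [integral_sub hd (hmul' hI), integral_sub (hmul' hut) (hmul' hu),
      hFTC, sub_self]
  filter_upwards [hmain] with v hv using sub_eq_zero.1 hv

/-- The `L¹` estimate for integrable weak solutions of `E · ∇u + ν u = h`. -/
theorem integral_freq_mul_abs_le_of_weak {u h ν : V → ℝ} {E : V} {ν₂ : ℝ} (hu : Integrable u μ)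
    (hh : Integrable h μ) (hν : Continuous ν) (hν0 : ∀ v, 0 ≤ ν v) (hν₂ : ∀ v, ν v ≤ ν₂)
    (hw : ∀ φ : V → ℝ, ContDiff ℝ ∞ φ → HasCompactSupport φ →
      -∫ v, u v * fderiv ℝ φ v E ∂μ = ∫ v, (h v - ν v * u v) * φ v ∂μ) :
    ∫ v, ν v * |u v| ∂μ ≤ ∫ v, |h v| ∂μ := by
  have hνu : Integrable (fun v => ν v * u v) μ :=
    hu.bdd_mul (c := ν₂) hν.aestronglyMeasurable (Eventually.of_forall fun v => by
      rw [Real.norm_eq_abs, abs_of_nonneg (hν0 v)]; exact hν₂ v)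
  have hνu' : Integrable (fun v => ν v * |u v|) μ :=
    hνu.norm.congr (Eventually.of_forall fun v => by
      simp only [norm_mul, Real.norm_eq_abs, abs_of_nonneg (hν0 v)])
  set k := fun v => h v - ν v * u v with hkdef
  have hk : Integrable k μ := hh.sub hνu
  refine le_of_forall_pos_le_add fun ε hε => ?_
  have hsmall := (tendsto_integral_norm_translate_sub hk E).eventually (gt_mem_nhds hε)
  obtain ⟨δ, hδ, hball⟩ := Metric.eventually_nhds_iff.1 hsmall
  have hν₂0 : 0 ≤ ν₂ := (hν0 0).trans (hν₂ 0)
  -- `t * ν₂ ≤ 1` keeps `1 - t ν` nonnegative, and `t < δ` keeps the translation error of `k` below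
  -- `ε` in `L¹`.
  obtain ⟨t, ht0, htδ, htν⟩ : ∃ t : ℝ, 0 < t ∧ t < δ ∧ t * ν₂ ≤ 1 := by
    refine ⟨min (δ / 2) (1 / (ν₂ + 1)), by positivity, ?_, ?_⟩
    · exact (min_le_left _ _).trans_lt (by linarith)
    · calc _ ≤ 1 / (ν₂ + 1) * ν₂ := by gcongr; exact min_le_right _ _
        _ ≤ 1 := by rw [one_div_mul_eq_div, div_le_one (by positivity)]; linarith
  have hki := integrable_line_translate hk E t
  have hq : Integrable (fun p : ℝ × V => ‖k (p.2 + p.1 • E) - k p.2‖)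
      ((volume.restrict (Set.Ioc 0 t)).prod μ) := (hki.sub (hk.comp_snd _)).norm
  set q : V → ℝ := fun v => ∫ τ in Set.Ioc 0 t, ‖k (v + τ • E) - k v‖ with hqdef
  have hqi : Integrable q μ := hq.integral_prod_right
  have hqle : ∫ v, q v ∂μ ≤ t * ε := by
    rw [hqdef, ← integral_integral_swap hq]
    calc ∫ τ in Set.Ioc 0 t, ∫ v, ‖k (v + τ • E) - k v‖ ∂μ ≤ ∫ _ in Set.Ioc 0 t, ε := by
          refine setIntegral_mono_on hq.integral_prod_left (by simp) measurableSet_Ioc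
            fun τ hτ => (hball ?_).le
          rw [Real.dist_eq, sub_zero, abs_of_pos hτ.1]
          exact hτ.2.trans_lt htδ
      _ = t * ε := by simp [ht0.le]
  -- One explicit Euler step along the line, with error `q`. It replaces a chain rule for `|u|`:
  -- after integration `∫ |u|` cancels by translation invariance, and dividing by `t` leaves the
  -- estimate up to `ε`.
  have hpt : ∀ᵐ v ∂μ, |u (v + t • E)| ≤ |u v| - t * (ν v * |u v|) + t * |h v| + q v := by
    filter_upwards [translate_sub_eq_integral_of_weak hu hk hw ht0.le,
      hki.prod_left_ae] with v h1 h2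
    rw [intervalIntegral.integral_of_le ht0.le] at h1
    have h3 : (∫ τ in Set.Ioc 0 t, k (v + τ • E)) - t * k v =
        ∫ τ in Set.Ioc 0 t, (k (v + τ • E) - k v) := by
      rw [integral_sub h2 (by simp)]
      simp [ht0.le]
    have h4 : |(∫ τ in Set.Ioc 0 t, k (v + τ • E)) - t * k v| ≤ q v := by
      rw [h3, ← Real.norm_eq_abs]
      exact norm_integral_le_integral_norm _
    have h5 : u (v + t • E) = (1 - t * ν v) * u v + t * h v +
        ((∫ τ in Set.Ioc 0 t, k (v + τ • E)) - t * k v) := by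
      rw [← h1, hkdef]; ring
    have h6 : 0 ≤ 1 - t * ν v := by nlinarith [hν₂ v]
    rw [h5]
    refine (abs_add_le _ _).trans (add_le_add ((abs_add_le _ _).trans ?_) h4)
    rw [abs_mul, abs_mul, abs_of_nonneg h6, abs_of_pos ht0]
    linarith
  have hi1 : Integrable (fun v => |u v| - t * (ν v * |u v|)) μ := hu.abs.sub (hνu'.const_mul t)
  have hi2 : Integrable (fun v => |u v| - t * (ν v * |u v|) + t * |h v|) μ :=
    hi1.add (hh.abs.const_mul t)
  have hint := integral_mono_ae (hu.comp_add_right (t • E)).abs (hi2.add hqi) hpt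
  have e1 : ∫ v, |u (v + t • E)| ∂μ = ∫ v, |u v| ∂μ :=
    integral_add_right_eq_self (fun v => |u v|) (t • E)
  have e2 : ∫ v, (|u v| - t * (ν v * |u v|) + t * |h v| + q v) ∂μ =
      ∫ v, |u v| ∂μ - t * ∫ v, ν v * |u v| ∂μ + t * ∫ v, |h v| ∂μ + ∫ v, q v ∂μ := by
    rw [integral_add hi2 hqi, integral_add hi1 (hh.abs.const_mul t),
      integral_sub hu.abs (hνu'.const_mul t), integral_const_mul, integral_const_mul]
  have hint' : ∫ v, |u v| ∂μ ≤
      ∫ v, |u v| ∂μ - t * ∫ v, ν v * |u v| ∂μ + t * ∫ v, |h v| ∂μ + ∫ v, q v ∂μ := by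
    rw [← e2]
    exact e1.symm.trans_le hint
  refine le_of_mul_le_mul_left ?_ ht0
  linarith

end WeakTransport

/-! ### The space `L²` with weight `1 / M` -/

section WeightedSpace

variable {d : ℕ} {M : EuclideanSpace ℝ (Fin d) → ℝ} {H : Type*} [NormedAddCommGroup H]

/-- Pointwise `‖f‖ ≤ ‖f‖² / M + M`, by completing the square, and both terms on the right are
integrable. -/
theorem integrable_of_memLp_invWeight (hMc : Continuous M) (hM0 : ∀ v, 0 < M v)
    (hMi : Integrable M) {f : EuclideanSpace ℝ (Fin d) → H} (hf : MemLp f 2 (invWeight M)) :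
    Integrable f := by
  have hdm : Measurable fun v => ENNReal.ofReal (M v)⁻¹ := hMc.measurable.inv.ennreal_ofReal
  have hac : (volume : Measure (EuclideanSpace ℝ (Fin d))) ≪ invWeight M :=
    withDensity_absolutelyContinuous' hdm.aemeasurable (Eventually.of_forall fun v => by
      simpa using hM0 v)
  have h2 : Integrable (fun v => ‖f v‖ ^ 2 * (M v)⁻¹) := by
    have h := hf.integrable_norm_pow (p := 2) two_ne_zero
    rw [invWeight, integrable_withDensity_iff hdm (Eventually.of_forall fun v =>
      ENNReal.ofReal_lt_top)] at h
    refine h.congr (Eventually.of_forall fun v => ?_)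
    simp only [ENNReal.toReal_ofReal (inv_nonneg.2 (hM0 v).le)]
  refine (h2.add hMi).mono' (hf.1.mono_ac hac) (Eventually.of_forall fun v => ?_)
  have hv := hM0 v
  have h3 : (‖f v‖ ^ 2 * (M v)⁻¹ + M v) - ‖f v‖ =
      ((‖f v‖ - M v / 2) ^ 2 + 3 / 4 * M v ^ 2) / M v := by
    field_simp
    ring
  have h4 : 0 ≤ ((‖f v‖ - M v / 2) ^ 2 + 3 / 4 * M v ^ 2) / M v := by positivity
  simp only [Pi.add_apply]
  linarith

/-- `M` itself has norm one, since `∫ M² / M = 1`. -/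
theorem eLpNorm_invWeight_le_of_norm_le_mul (hMc : Continuous M) (hM0 : ∀ v, 0 < M v)
    (hM1 : ∫ v, M v = 1) {f : EuclideanSpace ℝ (Fin d) → H} {B : ℝ}
    (hf : ∀ v, ‖f v‖ ≤ B * M v) : eLpNorm f 2 (invWeight M) ≤ ENNReal.ofReal B := by
  have hB : 0 ≤ B := nonneg_of_mul_nonneg_left ((norm_nonneg _).trans (hf 0)) (hM0 0)
  have hdm : Measurable fun v => ENNReal.ofReal (M v)⁻¹ := hMc.measurable.inv.ennreal_ofReal
  have h1 : eLpNorm M 2 (invWeight M) = 1 := by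
    rw [eLpNorm_eq_lintegral_rpow_enorm_toReal two_ne_zero ENNReal.ofNat_ne_top, invWeight,
      lintegral_withDensity_eq_lintegral_mul _ hdm (by
        have := hMc.measurable
        fun_prop)]
    have h2 : ∫⁻ v, ENNReal.ofReal (M v) = 1 := by
      rw [← ofReal_integral_eq_lintegral_ofReal (integrable_of_integral_eq_one hM1)
        (Eventually.of_forall fun v => (hM0 v).le), hM1, ENNReal.ofReal_one]
    have h3 : ∀ v, ((fun v => ENNReal.ofReal (M v)⁻¹) * fun v => ‖M v‖ₑ ^ (2 : ENNReal).toReal) v =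
        ENNReal.ofReal (M v) := fun v => by
      have hv := hM0 v
      simp only [Pi.mul_apply, ENNReal.toReal_ofNat, ENNReal.rpow_ofNat,
        Real.enorm_eq_ofReal hv.le]
      rw [← ENNReal.ofReal_pow hv.le, ← ENNReal.ofReal_mul (by positivity)]
      congr 1
      field_simp
    simp only [h3, h2, ENNReal.one_rpow]
  calc eLpNorm f 2 (invWeight M) ≤ eLpNorm (B • M) 2 (invWeight M) :=
        eLpNorm_mono_real hf
    _ = ENNReal.ofReal B := by
        rw [eLpNorm_const_smul, h1, mul_one, Real.enorm_eq_ofReal hB]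

theorem memLp_invWeight_of_norm_le_mul (hMc : Continuous M) (hM0 : ∀ v, 0 < M v)
    (hM1 : ∫ v, M v = 1) {f : EuclideanSpace ℝ (Fin d) → H} (hfc : Continuous f) {B : ℝ}
    (hf : ∀ v, ‖f v‖ ≤ B * M v) : MemLp f 2 (invWeight M) :=
  ⟨hfc.aestronglyMeasurable,
    (eLpNorm_invWeight_le_of_norm_le_mul hMc hM0 hM1 hf).trans_lt ENNReal.ofReal_lt_top⟩

end WeightedSpace

/-! ### Uniqueness and the linear response -/

section Equilibria

variable {d : ℕ} {α : ℝ} {M : EuclideanSpace ℝ (Fin d) → ℝ}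
  {σ : EuclideanSpace ℝ (Fin d) → EuclideanSpace ℝ (Fin d) → ℝ}

theorem neg_integral_mul_fderiv_eq_of_hasLineDerivAt {f f' φ : EuclideanSpace ℝ (Fin d) → ℝ}
    {E : EuclideanSpace ℝ (Fin d)} (hf : Integrable f) (hf' : Integrable f')
    (hd : ∀ v, HasLineDerivAt ℝ f (f' v) v E) (hφ : ContDiff ℝ ∞ φ) (hφc : HasCompactSupport φ) :
    -∫ v, f v * fderiv ℝ φ v E = ∫ v, f' v * φ v := by
  obtain ⟨C, hC⟩ := hφc.exists_bound_of_continuous hφ.continuous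
  have hφ1 : Continuous fun v => fderiv ℝ φ v E :=
    (hφ.continuous_fderiv (by simp)).clm_apply continuous_const
  obtain ⟨C', hC'⟩ := (hφc.fderiv_apply (𝕜 := ℝ) E).exists_bound_of_continuous hφ1
  have h := integral_bilinear_hasLineDerivAt_right_eq_neg_left_of_integrable (μ := volume)
    (f := f) (f' := f') (g := φ) (g' := fun v => fderiv ℝ φ v E) (v := E)
    (B := ContinuousLinearMap.mul ℝ ℝ)
    (hf'.mul_bdd (c := C) hφ.continuous.aestronglyMeasurable (Eventually.of_forall hC))
    (hf.mul_bdd (c := C') hφ1.aestronglyMeasurable (Eventually.of_forall hC'))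
    (hf.mul_bdd (c := C) hφ.continuous.aestronglyMeasurable (Eventually.of_forall hC))
    (fun v _ => hd v)
    (fun v _ => ((hφ.differentiable (by simp)) v).hasFDerivAt.hasLineDerivAt E)
  simp only [ContinuousLinearMap.mul_apply'] at h
  rw [h, neg_neg]

namespace CollisionKernel

variable {ν₁ ν₂ : ℝ} (K : CollisionKernel σ M ν₁ ν₂)
  {H : Type*} [NormedAddCommGroup H] [NormedSpace ℝ H] [CompleteSpace H]
include K

omit [CompleteSpace H] in
/-- The gain operator without its lower part is a strict contraction for the `L¹` norm weighted
by the collision frequency. -/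
theorem ae_eq_zero_of_integral_freq_mul_norm_le {u : EuclideanSpace ℝ (Fin d) → H}
    (hu : Integrable u) (h : ∫ v, collisionFreq σ M v * ‖u v‖ ≤
      ∫ v, ‖M v • kernelAverage σ ν₁ u v‖) : ∀ᵐ v, u v = 0 := by
  have h1 : ∫ v, ‖M v • kernelAverage σ ν₁ u v‖ ≤
      ∫ v, M v • kernelAverage σ ν₁ (fun w => ‖u w‖) v := by
    refine integral_mono (K.integrable_weight_smul_kernelAverage hu).norm
      (K.integrable_weight_smul_kernelAverage hu.norm) fun v => ?_
    simp only [norm_smul, Real.norm_eq_abs, abs_of_pos (K.weight_pos v), smul_eq_mul]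
    exact mul_le_mul_of_nonneg_left (K.norm_kernelAverage_le u v) (K.weight_pos v).le
  rw [K.integral_weight_smul_kernelAverage hu.norm] at h1
  simp only [smul_eq_mul] at h1
  have h2 : ∫ v, ‖u v‖ = 0 := by
    refine le_antisymm ?_ (integral_nonneg fun v => norm_nonneg _)
    have := K.pos
    by_contra hlt
    have : 0 < ν₁ * ∫ v, ‖u v‖ := mul_pos this (not_le.1 hlt)
    linarith
  filter_upwards [(integral_eq_zero_iff_of_nonneg (fun v => norm_nonneg _) hu.norm).1 h2]
    with v hv using norm_eq_zero.1 hv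

theorem boltzmannQ_eq_of_integral {f : EuclideanSpace ℝ (Fin d) → H} (hf : Integrable f) (v) :
    boltzmannQ σ M f v = M v • kernelAverage σ ν₁ f v + (ν₁ * M v) • (∫ w, f w) -
      collisionFreq σ M v • f v := by
  rw [K.boltzmannQ_eq hf, K.kernelAverage_zero_eq hf, smul_add, smul_smul, mul_comm (M v)]

theorem integrable_boltzmannQ {f : EuclideanSpace ℝ (Fin d) → H} (hf : Integrable f) :
    Integrable (boltzmannQ σ M f) := by
  refine (((K.integrable_weight_smul_kernelAverage hf).add
    ((K.integrable_weight.const_mul ν₁).smul_const (∫ w, f w))).sub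
    (K.integrable_freq_smul hf)).congr (Eventually.of_forall fun v => ?_)
  simp only [Pi.sub_apply, Pi.add_apply, K.boltzmannQ_eq_of_integral hf]

theorem boltzmannQ_sub_eq {f g : EuclideanSpace ℝ (Fin d) → H} (hf : Integrable f)
    (hg : Integrable g) (hfg : ∫ v, f v = ∫ v, g v) (v) :
    boltzmannQ σ M f v - boltzmannQ σ M g v =
      M v • kernelAverage σ ν₁ (fun w => f w - g w) v - collisionFreq σ M v • (f v - g v) := by
  rw [K.boltzmannQ_eq_of_integral hf, K.boltzmannQ_eq_of_integral hg, hfg,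
    K.kernelAverage_sub hf hg]
  module

theorem ae_eq_of_isModifiedEquilibrium {E : EuclideanSpace ℝ (Fin d)}
    {f F : EuclideanSpace ℝ (Fin d) → ℝ} (hf : IsModifiedEquilibrium σ M E f)
    (hF : IsModifiedEquilibrium σ M E F) : f =ᵐ[volume] F := by
  have hfi := integrable_of_memLp_invWeight K.continuous_weight K.weight_pos K.integrable_weight
    hf.memLp
  have hFi := integrable_of_memLp_invWeight K.continuous_weight K.weight_pos K.integrable_weight
    hF.memLp
  have hu : Integrable fun v => f v - F v := hfi.sub hFi
  -- For equal masses the `ν₁` part of the gain cancels in the difference, leaving the source `M K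
  -- u`, on which the strict contraction applies.
  have h := integral_freq_mul_abs_le_of_weak (E := E) hu
    (K.integrable_weight_smul_kernelAverage hu) K.continuous_collisionFreq
    (fun v => K.pos.le.trans (K.le_collisionFreq v)) K.collisionFreq_le fun φ hφ hφc => ?_
  · filter_upwards [K.ae_eq_zero_of_integral_freq_mul_norm_le hu h] with v hv using sub_eq_zero.1 hv
  · obtain ⟨C, hC⟩ := hφc.exists_bound_of_continuous hφ.continuous
    have hφ1 : Continuous fun v => fderiv ℝ φ v E :=
      (hφ.continuous_fderiv (by simp)).clm_apply continuous_const
    obtain ⟨C', hC'⟩ := (hφc.fderiv_apply (𝕜 := ℝ) E).exists_bound_of_continuous hφ1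
    have i1 : ∀ {g : EuclideanSpace ℝ (Fin d) → ℝ}, Integrable g →
        Integrable fun v => g v * fderiv ℝ φ v E := fun hg =>
      hg.mul_bdd (c := C') hφ1.aestronglyMeasurable (Eventually.of_forall hC')
    have i2 : ∀ {g : EuclideanSpace ℝ (Fin d) → ℝ}, Integrable g →
        Integrable fun v => g v * φ v := fun hg =>
      hg.mul_bdd (c := C) hφ.continuous.aestronglyMeasurable (Eventually.of_forall hC)
    have e : ∀ v, M v • kernelAverage σ ν₁ (fun w => f w - F w) v -
        collisionFreq σ M v * (f v - F v) = boltzmannQ σ M f v - boltzmannQ σ M F v := fun v => by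
      rw [K.boltzmannQ_sub_eq hfi hFi (hf.mass.trans hF.mass.symm)]
      rfl
    simp only [e, sub_mul]
    rw [integral_sub (i1 hfi) (i1 hFi), integral_sub (i2 (K.integrable_boltzmannQ hfi))
      (i2 (K.integrable_boltzmannQ hFi)), ← hf.weak_eq φ hφ hφc, ← hF.weak_eq φ hφ hφc]
    ring

theorem ae_eq_of_boltzmannQ_ae_eq {l₁ l₂ : EuclideanSpace ℝ (Fin d) → H} (h₁ : Integrable l₁)
    (h₂ : Integrable l₂) (hint : ∫ v, l₁ v = ∫ v, l₂ v)
    (hQ : boltzmannQ σ M l₁ =ᵐ[volume] boltzmannQ σ M l₂) : l₁ =ᵐ[volume] l₂ := by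
  have hu : Integrable fun v => l₁ v - l₂ v := h₁.sub h₂
  have h := K.ae_eq_zero_of_integral_freq_mul_norm_le hu (le_of_eq (integral_congr_ae ?_))
  · filter_upwards [h] with v hv using sub_eq_zero.1 hv
  · filter_upwards [hQ] with v hv
    have h3 := K.boltzmannQ_sub_eq h₁ h₂ hint v
    rw [hv, sub_self] at h3
    rw [sub_eq_zero.1 h3.symm, norm_smul, Real.norm_eq_abs,
      abs_of_nonneg (K.pos.le.trans (K.le_collisionFreq v))]

end CollisionKernel

namespace HeavyTailEquilibrium

variable (hM : HeavyTailEquilibrium α M)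
include hM

theorem continuous_gradient : Continuous (gradient M) :=
  (LinearIsometryEquiv.continuous _).comp hM.differentiable_fderiv.continuous

theorem norm_gradient_le : ∃ C, ∀ v, ‖gradient M v‖ ≤ C * M v := by
  obtain ⟨C, hC⟩ := hM.fderiv_bound
  refine ⟨|C|, fun v => ?_⟩
  have hv := hM.pos v
  rw [gradient, LinearIsometryEquiv.norm_map]
  refine (hC v).trans (mul_le_mul (le_abs_self C) (div_le_self hv.le ?_) (by positivity)
    (abs_nonneg C))
  linarith [norm_nonneg v]

/-- `M` is even, so its gradient is odd. This is what gives the linear response mean zero. -/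
theorem integral_gradient : ∫ v, gradient M v = 0 := by
  have hodd : ∀ v, gradient M (-v) = -gradient M v := fun v => by
    have h := ((hM.differentiable (-v)).hasFDerivAt.comp v (hasFDerivAt_id v).neg).fderiv
    have h2 : M ∘ Neg.neg = M := funext hM.even
    rw [h2, ContinuousLinearMap.comp_neg, ContinuousLinearMap.comp_id] at h
    rw [gradient, gradient, h, map_neg, neg_neg]
  have h := integral_neg_eq_self (gradient M) volume
  simp only [hodd, integral_neg] at h
  have h3 : (2 : ℝ) • ∫ v, gradient M v = 0 := by
    rw [two_smul]
    nth_rewrite 1 [← h]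
    exact neg_add_cancel _
  exact (smul_eq_zero.1 h3).resolve_left two_ne_zero

theorem hasLineDerivAt_gradient (v E : EuclideanSpace ℝ (Fin d)) :
    HasLineDerivAt ℝ (gradient M) ((InnerProductSpace.toDual ℝ (EuclideanSpace ℝ (Fin d))).symm
      (fderiv ℝ (fderiv ℝ M) v E)) v E := by
  have h := (hM.differentiable_fderiv v).hasFDerivAt
  have h2 := (InnerProductSpace.toDual ℝ
    (EuclideanSpace ℝ (Fin d))).symm.toContinuousLinearEquiv.toContinuousLinearMap.hasFDerivAt.comp
      v h
  exact h2.hasLineDerivAt E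

end HeavyTailEquilibrium

/-- This is the stationary problem at `E = 0`, where transport disappears, with source `-∇M / M`;
that source is bounded because `|∇M| ≤ C M`. -/
theorem CollisionKernel.exists_linearResponse {ν₁ ν₂ : ℝ} (K : CollisionKernel σ M ν₁ ν₂)
    (hM : HeavyTailEquilibrium α M) :
    ∃ lam : EuclideanSpace ℝ (Fin d) → EuclideanSpace ℝ (Fin d), Continuous lam ∧
      (∃ B, ∀ v, ‖lam v‖ ≤ B * M v) ∧ (∀ v, boltzmannQ σ M lam v = gradient M v) ∧
      ∫ v, lam v = 0 := by
  obtain ⟨A, hA⟩ := K.exists_dampedTransport hM 0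
  have D := hA 0 (by simp)
  obtain ⟨C, hC⟩ := hM.norm_gradient_le
  let s : BoundedContinuousFunction (EuclideanSpace ℝ (Fin d)) (EuclideanSpace ℝ (Fin d)) :=
    BoundedContinuousFunction.ofNormedAddCommGroup (fun v => -((M v)⁻¹ • gradient M v))
      (((hM.continuous.inv₀ fun v => (hM.pos v).ne').smul hM.continuous_gradient).neg) C
      fun v => by
        have hv := hM.pos v
        rw [norm_neg, norm_smul, norm_inv, Real.norm_eq_abs, abs_of_pos hv,
          inv_mul_le_iff₀ hv, mul_comm]
        exact hC v
  have hs : ∀ v, M v • s v = -gradient M v := fun v => by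
    change M v • -((M v)⁻¹ • gradient M v) = _
    rw [smul_neg, smul_smul, mul_inv_cancel₀ (hM.pos v).ne', one_smul]
  obtain ⟨lam, hc, ⟨B, hB⟩, -, hd, hm⟩ := K.exists_stationary D s
  have hi : Integrable lam := integrable_of_norm_le_mul K.integrable_weight hc hB
  have hm0 : ∫ v, lam v = 0 := by
    simp only [hs, integral_neg, hM.integral_gradient, neg_zero] at hm
    exact (smul_eq_zero.1 hm).resolve_left K.pos.ne'
  refine ⟨lam, hc, ⟨B, hB⟩, fun v => ?_, hm0⟩
  -- A derivative in the direction `0` vanishes, so the transport equation reduces to an algebraic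
  -- identity at every `v`.
  have h1 : M v • (s v + kernelAverage σ ν₁ lam v) - collisionFreq σ M v • lam v = 0 := by
    have h2 := hd v
    rw [HasLineDerivAt] at h2
    simp only [smul_zero, add_zero] at h2
    exact h2.unique (hasDerivAt_const (0 : ℝ) (lam v))
  rw [smul_add, hs] at h1
  rw [K.boltzmannQ_eq_of_integral hi, hm0, smul_zero, add_zero]
  rw [← sub_eq_zero, ← h1]
  abel

end Equilibria

/-! ### Regularity of the linear response and the remainder -/

section Expansion

variable {d : ℕ} {α : ℝ} {M : EuclideanSpace ℝ (Fin d) → ℝ}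
  {σ : EuclideanSpace ℝ (Fin d) → EuclideanSpace ℝ (Fin d) → ℝ}

/-- The derivative falls on `σ` alone, so `f` need only be integrable. Symmetry of `σ` transfers the
gradient bound to the variable being moved. -/
theorem CollisionKernel.exists_hasLineDerivAt_kernelAverage {ν₁ ν₂ : ℝ}
    (K : CollisionKernel σ M ν₁ ν₂) {H : Type*} [NormedAddCommGroup H] [NormedSpace ℝ H]
    (hσd : ∀ v', Differentiable ℝ (σ v')) {C : ℝ} (hσ : ∀ v' v, ‖fderiv ℝ (σ v') v‖ ≤ C)
    {f : EuclideanSpace ℝ (Fin d) → H} (hf : Integrable f) (c : ℝ) (v E : EuclideanSpace ℝ (Fin d)) :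
    ∃ D, HasLineDerivAt ℝ (kernelAverage σ c f) D v E ∧ ‖D‖ ≤ C * ‖E‖ * ∫ v', ‖f v'‖ := by
  have hbound : ∀ (t : ℝ) v', ‖fderiv ℝ (σ v') (v + t • E) E • f v'‖ ≤ C * ‖E‖ * ‖f v'‖ :=
    fun t v' => by
      rw [norm_smul]
      gcongr
      exact (ContinuousLinearMap.le_opNorm _ _).trans (by gcongr; exact hσ _ _)
  have hmeas : Measurable fun v' => fderiv ℝ (σ v') v E :=
    (measurable_fderiv_apply_const_with_param ℝ K.continuous_kernel E).comp
      (measurable_id.prodMk measurable_const)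
  have h := (hasDerivAt_integral_of_dominated_loc_of_deriv_le (μ := volume) (x₀ := (0 : ℝ))
    (s := Set.univ)
    (F := fun t v' => (σ (v + t • E) v' - c) • f v')
    (F' := fun t v' => fderiv ℝ (σ v') (v + t • E) E • f v')
    (bound := fun v' => C * ‖E‖ * ‖f v'‖) univ_mem
    (Eventually.of_forall fun t => (K.integrable_kernel_sub_smul hf c _).aestronglyMeasurable)
    (K.integrable_kernel_sub_smul hf c _)
    (by
      simp only [zero_smul, add_zero]
      exact hmeas.aestronglyMeasurable.smul hf.aestronglyMeasurable)
    (Eventually.of_forall fun v' t _ => hbound t v') (hf.norm.const_mul _)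
    (Eventually.of_forall fun v' t _ => by
      have h1 : HasDerivAt (fun t : ℝ => v + t • E) ((1 : ℝ) • E) t :=
        ((hasDerivAt_id t).smul_const E).const_add v
      have h2 := (hσd v' (v + t • E)).hasFDerivAt.comp_hasDerivAt t h1
      rw [one_smul] at h2
      have h3 := (h2.sub_const c).smul_const (f v')
      simpa only [K.symm _ v', Function.comp] using h3)).2
  refine ⟨_, h, ?_⟩
  rw [← integral_const_mul]
  exact norm_integral_le_of_norm_le (hf.norm.const_mul _)
    (Eventually.of_forall fun v' => hbound 0 v')

/-- The linear response is differentiable, with derivative dominated by the equilibrium. -/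
theorem CollisionKernel.exists_hasLineDerivAt_of_boltzmannQ_eq {ν₁ ν₂ : ℝ}
    (K : CollisionKernel σ M ν₁ ν₂) (hM : HeavyTailEquilibrium α M)
    (hσ : AdmissibleCrossSection M σ)
    {lam : EuclideanSpace ℝ (Fin d) → EuclideanSpace ℝ (Fin d)} (hi : Integrable lam)
    (hQ : ∀ v, boltzmannQ σ M lam v = gradient M v) :
    ∃ C, 0 ≤ C ∧ ∀ v E, ∃ D, HasLineDerivAt ℝ lam D v E ∧ ‖D‖ ≤ C * M v * ‖E‖ := by
  obtain ⟨Cσ, hCσ⟩ := hσ.fderiv_bound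
  have hCσ0 : 0 ≤ Cσ := by simpa using (norm_nonneg _).trans (hCσ 0 0)
  have hCσ' : ∀ v' v, ‖fderiv ℝ (σ v') v‖ ≤ Cσ := fun v' v =>
    (hCσ v' v).trans (div_le_self hCσ0 (by linarith [norm_nonneg v]))
  obtain ⟨C₁, hC₁⟩ := hM.norm_gradient_le
  obtain ⟨C₂, hC₂⟩ := hM.fderiv_fderiv_bound
  have hC₁0 : 0 ≤ C₁ := nonneg_of_mul_nonneg_left ((norm_nonneg _).trans (hC₁ 0)) (hM.pos 0)
  have hC₂0 : 0 ≤ C₂ :=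
    nonneg_of_mul_nonneg_left ((norm_nonneg (fderiv ℝ (fderiv ℝ M) 0)).trans (hC₂ 0)) (hM.pos 0)
  have hν₁ := K.pos
  have hν₂ : 0 ≤ ν₂ := hν₁.le.trans K.lower_le_upper
  set I := ∫ v', ‖lam v'‖ with hI
  have hI0 : 0 ≤ I := integral_nonneg fun _ => norm_nonneg _
  have havg : ∀ v, ‖kernelAverage σ 0 lam v‖ ≤ ν₂ * I := fun v => by
    rw [hI, ← integral_const_mul]
    refine norm_integral_le_of_norm_le (hi.norm.const_mul _) (Eventually.of_forall fun v' => ?_)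
    rw [sub_zero, norm_smul]
    gcongr
    exact K.abs_le v v'
  -- Solving `Q(λ) = ∇M` for `λ(v)` leaves `λ` on the right only under an average, hence
  -- differentiable. Every factor is then controlled by the bounds on `∇σ`, `∇M` and `D²M`.
  have hlam : lam = fun v => (kernelAverage σ 0 M v)⁻¹ •
      (M v • kernelAverage σ 0 lam v - gradient M v) := funext fun v => by
    have hν : kernelAverage σ 0 M v = collisionFreq σ M v := by
      simp [kernelAverage, K.collisionFreq_eq]
    have hpos : collisionFreq σ M v ≠ 0 := (hν₁.trans_le (K.le_collisionFreq v)).ne'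
    rw [hν, ← hQ, K.boltzmannQ_eq hi, sub_sub_cancel, smul_smul, inv_mul_cancel₀ hpos, one_smul]
  refine ⟨ν₁⁻¹ * (Cσ * I + C₁ * (ν₂ * I) + C₂) + Cσ / ν₁ ^ 2 * (ν₂ * I + C₁), by positivity,
    fun v E => ?_⟩
  obtain ⟨Dν, hDν, hDν'⟩ := K.exists_hasLineDerivAt_kernelAverage hσ.differentiable hCσ'
    K.integrable_weight 0 v E
  obtain ⟨Da, hDa, hDa'⟩ := K.exists_hasLineDerivAt_kernelAverage hσ.differentiable hCσ' hi 0 v E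
  have hDM := (hM.differentiable v).hasFDerivAt.hasLineDerivAt E
  have hDg := hM.hasLineDerivAt_gradient v E
  have hMv := hM.pos v
  have hDM' : ‖fderiv ℝ M v E‖ ≤ C₁ * M v * ‖E‖ := by
    refine (ContinuousLinearMap.le_opNorm _ _).trans (mul_le_mul_of_nonneg_right ?_ (norm_nonneg E))
    have h := hC₁ v
    rwa [gradient, LinearIsometryEquiv.norm_map] at h
  have hDg' : ‖(InnerProductSpace.toDual ℝ (EuclideanSpace ℝ (Fin d))).symm
      (fderiv ℝ (fderiv ℝ M) v E)‖ ≤ C₂ * M v * ‖E‖ := by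
    rw [LinearIsometryEquiv.norm_map]
    exact (ContinuousLinearMap.le_opNorm _ _).trans
      (mul_le_mul_of_nonneg_right (hC₂ v) (norm_nonneg E))
  simp only [Real.norm_eq_abs, abs_of_pos (hM.pos _), hM.integral_eq_one, mul_one] at hDν'
  have hνv : ν₁ ≤ kernelAverage σ 0 M v := by
    have := K.le_collisionFreq v
    rw [K.collisionFreq_eq] at this
    simpa [kernelAverage] using this
  have hν0 : 0 < kernelAverage σ 0 M v := hν₁.trans_le hνv
  rw [HasLineDerivAt] at hDν hDa hDM hDg
  have hw := (hDM.smul hDa).sub hDg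
  have hinv := hDν.inv (by simpa using hν0.ne')
  have hD : HasLineDerivAt ℝ lam ((kernelAverage σ 0 M v)⁻¹ • (M v • Da +
      fderiv ℝ M v E • kernelAverage σ 0 lam v -
        (InnerProductSpace.toDual ℝ (EuclideanSpace ℝ (Fin d))).symm
          (fderiv ℝ (fderiv ℝ M) v E)) +
      (-Dν / kernelAverage σ 0 M v ^ 2) •
        (M v • kernelAverage σ 0 lam v - gradient M v)) v E := by
    refine ((hinv.smul hw).congr_deriv ?_).congr_of_eventuallyEq
      (Eventually.of_forall fun t => congrFun hlam (v + t • E))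
    simp
  refine ⟨_, hD, ?_⟩
  have hinvle : ‖(kernelAverage σ 0 M v)⁻¹‖ ≤ ν₁⁻¹ := by
    rw [norm_inv, Real.norm_eq_abs, abs_of_pos hν0]
    exact inv_anti₀ hν₁ hνv
  have hdiv : ‖-Dν / kernelAverage σ 0 M v ^ 2‖ ≤ Cσ * ‖E‖ / ν₁ ^ 2 := by
    rw [norm_div, norm_neg, norm_pow, Real.norm_eq_abs (kernelAverage σ 0 M v), abs_of_pos hν0]
    gcongr
    exact hDν'
  have h1 : ‖M v • Da + fderiv ℝ M v E • kernelAverage σ 0 lam v -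
      (InnerProductSpace.toDual ℝ (EuclideanSpace ℝ (Fin d))).symm
        (fderiv ℝ (fderiv ℝ M) v E)‖ ≤
      M v * (Cσ * ‖E‖ * I) + C₁ * M v * ‖E‖ * (ν₂ * I) + C₂ * M v * ‖E‖ := by
    refine (norm_sub_le _ _).trans (add_le_add ((norm_add_le _ _).trans (add_le_add ?_ ?_)) hDg')
    · rw [norm_smul, Real.norm_eq_abs, abs_of_pos hMv]
      gcongr
    · rw [norm_smul]
      exact mul_le_mul hDM' (havg v) (norm_nonneg _) (by positivity)
  have h2 : ‖M v • kernelAverage σ 0 lam v - gradient M v‖ ≤ M v * (ν₂ * I) + C₁ * M v := by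
    refine (norm_sub_le _ _).trans (add_le_add ?_ (hC₁ v))
    rw [norm_smul, Real.norm_eq_abs, abs_of_pos hMv]
    gcongr
    exact havg v
  refine (norm_add_le _ _).trans ((add_le_add (norm_smul_le _ _) (norm_smul_le _ _)).trans
    ((add_le_add (mul_le_mul hinvle h1 (norm_nonneg _) (by positivity))
      (mul_le_mul hdiv h2 (norm_nonneg _) (by positivity))).trans_eq ?_))
  ring

/-- The remainder of the first-order expansion of a modified equilibrium in the field `E`. -/
theorem CollisionKernel.abs_remainder_le {ν₁ ν₂ : ℝ} (K : CollisionKernel σ M ν₁ ν₂)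
    (hM : HeavyTailEquilibrium α M) {E : EuclideanSpace ℝ (Fin d)} {A C B B' : ℝ} (hC : 0 ≤ C)
    (D : DampedTransport (collisionFreq σ M) M E (ν₁ / 2) A)
    {F : EuclideanSpace ℝ (Fin d) → ℝ} (hFc : Continuous F) (hFB : ∀ v, ‖F v‖ ≤ B * M v)
    (hFd : ∀ v, HasLineDerivAt ℝ F (boltzmannQ σ M F v) v E) (hF1 : ∫ v, F v = 1)
    {lam : EuclideanSpace ℝ (Fin d) → EuclideanSpace ℝ (Fin d)} (hlc : Continuous lam)
    (hlB : ∀ v, ‖lam v‖ ≤ B' * M v) (hlQ : ∀ v, boltzmannQ σ M lam v = gradient M v)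
    (hl0 : ∫ v, lam v = 0)
    (hld : ∀ v, ∃ D, HasLineDerivAt ℝ lam D v E ∧ ‖D‖ ≤ C * M v * ‖E‖) (v) :
    |F v - M v - inner ℝ E (lam v)| ≤
      (C * (1 + (ν₂ - ν₁) / ν₁)) * A / (ν₁ / 2) * ‖E‖ ^ 2 * M v := by
  have hν₁ := K.pos
  choose Dl hDl hDl' using hld
  have hFi : Integrable F := integrable_of_norm_le_mul K.integrable_weight hFc hFB
  have hli : Integrable lam := integrable_of_norm_le_mul K.integrable_weight hlc hlB
  have hEl : Integrable fun v => inner ℝ E (lam v) := hli.const_inner E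
  have hFM : Integrable fun v => F v - M v := hFi.sub K.integrable_weight
  set G := fun v => F v - M v - inner ℝ E (lam v) with hGdef
  have hGi : Integrable G := hFM.sub hEl
  have hGB : ∀ v, ‖G v‖ ≤ (B + 1 + ‖E‖ * B') * M v := fun v => by
    have h1 : ‖inner ℝ E (lam v)‖ ≤ ‖E‖ * (B' * M v) :=
      (norm_inner_le_norm E (lam v)).trans (by gcongr; exact hlB v)
    have h2 : ‖M v‖ = M v := by rw [Real.norm_eq_abs, abs_of_pos (K.weight_pos v)]
    calc ‖G v‖ ≤ ‖F v‖ + ‖M v‖ + ‖inner ℝ E (lam v)‖ :=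
          (norm_sub_le _ _).trans (add_le_add (norm_sub_le _ _) le_rfl)
      _ ≤ B * M v + M v + ‖E‖ * (B' * M v) := by linarith [hFB v]
      _ = _ := by ring
  -- Since `Q(M) = 0` and `E · Q(λ) = E · ∇M`, the terms of orders zero and one cancel. Only the
  -- derivative of `E · λ` along `E` remains as a source, of second order in `E`. As `∫ G = 0`, the
  -- `ν₁` part of the gain drops out.
  have hGd : ∀ v, HasLineDerivAt ℝ G ((M v • kernelAverage σ ν₁ G v - inner ℝ E (Dl v)) -
      collisionFreq σ M v • G v) v E := fun v => by
    have h1 := ((hFd v).sub ((hM.differentiable v).hasFDerivAt.hasLineDerivAt E)).sub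
      (HasDerivAt.inner ℝ (hasDerivAt_const (0 : ℝ) E) (hDl v))
    refine h1.congr_deriv ?_
    have hgrad : fderiv ℝ M v E = inner ℝ E (gradient M v) := by
      rw [real_inner_comm, gradient, InnerProductSpace.toDual_symm_apply]
    have hK1 : kernelAverage σ ν₁ G v = kernelAverage σ ν₁ F v - kernelAverage σ ν₁ M v -
        inner ℝ E (kernelAverage σ ν₁ lam v) := by
      rw [hGdef, K.kernelAverage_sub hFM hEl, K.kernelAverage_sub hFi K.integrable_weight]
      congr 1
      rw [kernelAverage, kernelAverage, ← integral_inner (K.integrable_kernel_sub_smul hli _ _)]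
      simp only [inner_smul_right, smul_eq_mul]
    have hK2 : kernelAverage σ ν₁ M v = collisionFreq σ M v - ν₁ := by
      have h := K.kernelAverage_zero_eq K.integrable_weight v
      rw [K.integral_weight, smul_eq_mul, mul_one] at h
      rw [K.collisionFreq_eq, eq_sub_iff_add_eq, ← h]
      simp [kernelAverage]
    have hlQv := hlQ v
    rw [K.boltzmannQ_eq_of_integral hli, hl0, smul_zero, add_zero] at hlQv
    rw [K.boltzmannQ_eq_of_integral hFi, hF1, hgrad, ← hlQv, hK1, hK2, hGdef]
    simp only [inner_sub_right, inner_smul_right, inner_zero_left, smul_eq_mul, add_zero]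
    ring
  set κ := C * ‖E‖ ^ 2 with hκ
  have hκ0 : 0 ≤ κ := by positivity
  have hKc := K.continuous_kernelAverage hGi.norm ν₁
  have hgc : Continuous fun w => M w • (κ + kernelAverage σ ν₁ (fun w => ‖G w‖) w) :=
    K.continuous_weight.smul (continuous_const.add hKc)
  have hgM : ∀ v, ‖M v • (κ + kernelAverage σ ν₁ (fun w => ‖G w‖) v)‖ ≤
      (κ + (ν₂ - ν₁) * ∫ v, ‖G v‖) * M v := K.norm_weight_smul_le fun v => by
    refine (norm_add_le _ _).trans (add_le_add ?_ ?_)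
    · rw [Real.norm_eq_abs, abs_of_nonneg hκ0]
    · simpa using K.norm_kernelAverage_le_mul hGi.norm v
  have hGT : ∀ v, ‖G v‖ ≤ transportInv (collisionFreq σ M) E
      (fun w => M w • (κ + kernelAverage σ ν₁ (fun w => ‖G w‖) w)) v :=
    D.norm_le_transportInv hGd hGB hgc hgM fun v => by
      have hMv := K.weight_pos v
      have h1 : ‖M v • kernelAverage σ ν₁ G v‖ ≤ M v * kernelAverage σ ν₁ (fun w => ‖G w‖) v := by
        rw [norm_smul, Real.norm_eq_abs, abs_of_pos hMv]
        exact mul_le_mul_of_nonneg_left (K.norm_kernelAverage_le G v) hMv.le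
      have h2 : ‖inner ℝ E (Dl v)‖ ≤ M v * κ := by
        refine (norm_inner_le_norm E (Dl v)).trans ?_
        calc ‖E‖ * ‖Dl v‖ ≤ ‖E‖ * (C * M v * ‖E‖) := by gcongr; exact hDl' v
          _ = M v * κ := by rw [hκ]; ring
      refine (norm_sub_le _ _).trans ?_
      simp only [smul_eq_mul, mul_add] at h1 ⊢
      linarith
  have hL1 := K.integral_norm_le_of_norm_le_transportInv D hκ0 hGi hGT
  have hA := D.A_pos
  have hMv := K.weight_pos v
  have hI : ∫ v, ‖G v‖ ≤ κ / ν₁ := by rwa [le_div_iff₀ hν₁, mul_comm]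
  have hsub : 0 ≤ ν₂ - ν₁ := sub_nonneg.2 K.lower_le_upper
  calc |G v| ≤ _ := hGT v
    _ ≤ _ := (le_abs_self _).trans (D.norm_transportInv_le_mul hgM v)
    _ ≤ (κ + (ν₂ - ν₁) * (κ / ν₁)) * A / (ν₁ / 2) * M v := by gcongr
    _ = _ := by rw [hκ]; ring

end Expansion

/-! ### Assembly -/

theorem proposition2p3 {d : ℕ} (α : ℝ)
    (M : EuclideanSpace ℝ (Fin d) → ℝ)
    (σ : EuclideanSpace ℝ (Fin d) → EuclideanSpace ℝ (Fin d) → ℝ)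
    (hM : HeavyTailEquilibrium α M) (hσ : AdmissibleCrossSection M σ) :
    ∃ (F : EuclideanSpace ℝ (Fin d) → EuclideanSpace ℝ (Fin d) → ℝ)
      (lam : EuclideanSpace ℝ (Fin d) → EuclideanSpace ℝ (Fin d))
      (G : EuclideanSpace ℝ (Fin d) → EuclideanSpace ℝ (Fin d) → ℝ),
      -- `F(·, E)` is the continuous representative of the unique solution, and it is positive
      (∀ E, IsModifiedEquilibrium σ M E (fun v => F v E) ∧
        Continuous (fun v => F v E) ∧ (∀ v, 0 < F v E) ∧
        ∀ f, IsModifiedEquilibrium σ M E f → f =ᵐ[volume] (fun v => F v E)) ∧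
      -- `lam` is the unique solution of `Q(lam) = ∇M` of mean zero
      (MemLp lam 2 (invWeight M) ∧ (∀ v, boltzmannQ σ M lam v = gradient M v) ∧
        ∫ v, lam v = 0 ∧
        ∀ l : EuclideanSpace ℝ (Fin d) → EuclideanSpace ℝ (Fin d),
          MemLp l 2 (invWeight M) → boltzmannQ σ M l =ᵐ[volume] gradient M →
          ∫ v, l v = 0 → l =ᵐ[volume] lam) ∧
      -- the expansion and the two bounds on the remainder
      (∀ v E, F v E = M v + inner ℝ E (lam v) + G v E) ∧
      ∃ C : ℝ, 0 < C ∧ ∀ E, ‖E‖ ≤ 1 →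
        eLpNorm (fun v => G v E) 2 (invWeight M) ≤ ENNReal.ofReal (C * ‖E‖ ^ 2) ∧
        ∀ v, |G v E| ≤ C * ‖E‖ ^ 2 * M v := by
  obtain ⟨ν₁, ν₂, K⟩ := hσ.exists_collisionKernel hM
  have hν₁ := K.pos
  have hexists : ∀ E, ∃ F : EuclideanSpace ℝ (Fin d) → ℝ, Continuous F ∧
      (∃ B, ∀ v, ‖F v‖ ≤ B * M v) ∧ (∀ v, 0 < F v) ∧
      (∀ v, HasLineDerivAt ℝ F (boltzmannQ σ M F v) v E) ∧ ∫ v, F v = 1 := fun E => by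
    obtain ⟨A, hA⟩ := K.exists_dampedTransport hM ‖E‖
    obtain ⟨F, hc, ⟨B, hB⟩, hp, hd, h1⟩ := K.exists_modifiedEquilibrium (hA E le_rfl)
    have hi : Integrable F := integrable_of_norm_le_mul K.integrable_weight hc hB
    exact ⟨F, hc, ⟨B, hB⟩, hp, fun v => by rw [K.boltzmannQ_eq hi]; exact hd v, h1⟩
  choose F hFc hFB hFp hFd hF1 using hexists
  obtain ⟨lam, hlc, ⟨B', hlB⟩, hlQ, hl0⟩ := K.exists_linearResponse hM
  have hli : Integrable lam := integrable_of_norm_le_mul K.integrable_weight hlc hlB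
  have hlL : MemLp lam 2 (invWeight M) :=
    memLp_invWeight_of_norm_le_mul K.continuous_weight K.weight_pos K.integral_weight hlc hlB
  have hFeq : ∀ E, IsModifiedEquilibrium σ M E (F E) := fun E => by
    obtain ⟨B, hB⟩ := hFB E
    have hi : Integrable (F E) := integrable_of_norm_le_mul K.integrable_weight (hFc E) hB
    exact ⟨memLp_invWeight_of_norm_le_mul K.continuous_weight K.weight_pos K.integral_weight
      (hFc E) hB, fun φ hφ hφc => neg_integral_mul_fderiv_eq_of_hasLineDerivAt hi
        (K.integrable_boltzmannQ hi) (hFd E) hφ hφc, hF1 E⟩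
  refine ⟨fun v E => F E v, lam, fun v E => F E v - M v - inner ℝ E (lam v),
    fun E => ⟨hFeq E, hFc E, hFp E, fun f hf => K.ae_eq_of_isModifiedEquilibrium hf (hFeq E)⟩,
    ⟨hlL, hlQ, hl0, fun l hl hQ h0 => ?_⟩, fun v E => by ring, ?_⟩
  · refine K.ae_eq_of_boltzmannQ_ae_eq (integrable_of_memLp_invWeight K.continuous_weight
      K.weight_pos K.integrable_weight hl) hli (h0.trans hl0.symm) ?_
    filter_upwards [hQ] with v hv using hv.trans (hlQ v).symm
  -- The bound `B` with `|F| ≤ B M` may depend on `E` but does not enter the remainder constant; `A`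
  -- does, and is taken uniform over the unit ball.
  · obtain ⟨A, hA⟩ := K.exists_dampedTransport hM 1
    obtain ⟨C, hC0, hC⟩ := K.exists_hasLineDerivAt_of_boltzmannQ_eq hM hσ hli hlQ
    have hA0 : 0 < A := (hA 0 (by simp)).A_pos
    have hsub : 0 ≤ ν₂ - ν₁ := sub_nonneg.2 K.lower_le_upper
    -- The `+ 1` makes the constant strictly positive even if `C = 0`.
    have hpt : ∀ E : EuclideanSpace ℝ (Fin d), ‖E‖ ≤ 1 → ∀ v,
        |F E v - M v - inner ℝ E (lam v)| ≤
          ((C * (1 + (ν₂ - ν₁) / ν₁)) * A / (ν₁ / 2) + 1) * ‖E‖ ^ 2 * M v := fun E hE v => by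
      obtain ⟨B, hB⟩ := hFB E
      refine (K.abs_remainder_le hM hC0 (hA E hE) (hFc E) hB (hFd E) (hF1 E) hlc hlB hlQ hl0
        (fun v => hC v E) v).trans ?_
      have hMv := K.weight_pos v
      gcongr
      linarith
    exact ⟨_, by positivity, fun E hE => ⟨eLpNorm_invWeight_le_of_norm_le_mul K.continuous_weight
      K.weight_pos K.integral_weight (hpt E hE), hpt E hE⟩⟩
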